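/- **Conventions.** All graphs are finite, simple, connected and undirected; $\partial$ denotes path-length distance. A graph $\Gamma$ with vertex set $X$ and diameter $D$ is *distance-regular* if for all $0\le h,i,j\le D$ the number $p^h_{ij}=|\{z\in X:\partial(x,z)=i,\ \partial(y,z)=j\}|$ is the same for all $x,y\in X$ with $\partial(x,y)=h$. Put $c_i=p^i_{1,i-1}$ $(1\le i\le D)$, $a_i=p^i_{1,i}$ $(0\le i\le D)$, $b_i=p^i_{1,i+1}$ $(0\le i\le D-1)$. With ${j\brack 1}=1+q+\dots+q^{j-1}$, $\Gamma$ has *classical parameters* $(D,q,\alpha,\beta)$ if $c_i={i\brack 1}\bigl(1+\alpha{i-1\brack 1}\bigr)$ for $1\le i\le D$ and $b_i=\bigl({D\brack 1}-{i\brack 1}\bigr)\bigl(\beta-\alpha{i\brack 1}\bigr)$ for $0\le i\le D-1$; it is of *negative type* if it has classical parameters $(D,q,\alpha,\beta)$ with $q<-1$. It is a *near polygon* if $a_i=a_1c_i$ for $1\le i\le D-1$ and it has no induced subgraph $K_{1,1,2}$. Fix $x\in X$, and let $\Gamma_f$ be the (bipartite, connected) graph obtained from $\Gamma$ by deleting all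 edges $yz$ with $\partial(x,y)=\partial(x,z)$. Let $\varepsilon$ be the eccentricity of $x$ in $\Gamma_f$, $V=\mathbb C^X$, and let $A_f$ be the adjacency matrix of $\Gamma_f$. Let $E_i^*$ be the diagonal matrix whose $(y,y)$-entry is $1$ if $y$ is at distance $i$ from $x$ and $0$ otherwise, and put $L=\sum_{i=1}^{\varepsilon}E^*_{i-1}A_fE^*_i$ and $R=\sum_{i=0}^{\varepsilon-1}E^*_{i+1}A_fE^*_i$. A *parameter matrix* is a tridiagonal complex matrix $U=(e_{ij})_{1\le i,j\le\varepsilon}$ such that (i) $e_{ii}=1$ for all $i$; (ii) either $e_{i,i-1}\ne0$ for all $2\le i\le\varepsilon$, or $e_{i-1,i}\neq0$ for all $2\le i\le\varepsilon$; (iii) the principal submatrix $(e_{ij})_{s\le i,j\le t}$ is nonsingular for all $1\le s\le t\le\varepsilon$. Write $e_i^-=e_{i,i-1}$ and $e_i^+=e_{i,i+1}$, with $e_1^-=e_\varepsilon^+=0$. The graph $\Gamma$ *supports a uniform structure with respect to $x$* if there are a parameter matrix $U$ and a vector $(f_1,\dots,f_\varepsilon)\in\mathbb C^\varepsilon$ such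 that $$e_i^-RL^2+LRL+e_i^+L^2R=f_iL\quad\text{on } E_i^*V\qquad(1\le i\le\varepsilon).$$ **Theorem 6.3 (nonzero).** Let $\Gamma$ be a distance-regular graph with diameter $D\ge3$ that is of negative type, has $a_1\neq0$, and is not a near polygon. Then for every vertex $x$ of $\Gamma$, the graph $\Gamma$ does not support a uniform structure with respect to $x$. -/

import Mathlib

namespace SimpleGraph

/-! ### Distance-regular graphs, classical parameters, near polygons -/

section DistanceRegular

variable {X : Type*} [Fintype X]

open Classical in
/-- The number `|Γ_i(x) ∩ Γ_j(y)|` of vertices at distance `i` from `x` and `j` from `y`. -/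
noncomputable def sphereInterCard (Γ : SimpleGraph X) (i j : ℕ) (x y : X) : ℕ :=
  (Finset.univ.filter fun z : X => Γ.dist x z = i ∧ Γ.dist y z = j).card

/-- A (connected) graph of diameter `D` is distance-regular if for all `0 ≤ h, i, j ≤ D` the number
`|Γ_i(x) ∩ Γ_j(y)|` is the same for all pairs of vertices `x, y` at distance `h`. -/
def IsDistanceRegular (Γ : SimpleGraph X) : Prop :=
  Γ.Connected ∧ ∀ h i j : ℕ, h ≤ Γ.diam → i ≤ Γ.diam → j ≤ Γ.diam →
    ∃ p : ℕ, ∀ x y : X, Γ.dist x y = h → Γ.sphereInterCard i j x y = p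

open Classical in
/-- The intersection number `p^h_{ij}` of a distance-regular graph: the value of
`|Γ_i(x) ∩ Γ_j(y)|` at some (equivalently, any) pair `x, y` at distance `h`. -/
noncomputable def intersectionNumber (Γ : SimpleGraph X) (h i j : ℕ) : ℕ :=
  if hp : ∃ p : X × X, Γ.dist p.1 p.2 = h then
    Γ.sphereInterCard i j hp.choose.1 hp.choose.2
  else 0

theorem IsDistanceRegular.sphereInterCard_eq {Γ : SimpleGraph X} (hΓ : Γ.IsDistanceRegular)
    {h i j : ℕ} (hh : h ≤ Γ.diam) (hi : i ≤ Γ.diam) (hj : j ≤ Γ.diam) {x y : X}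
    (hxy : Γ.dist x y = h) : Γ.sphereInterCard i j x y = Γ.intersectionNumber h i j := by
  obtain ⟨p, hp⟩ := hΓ.2 h i j hh hi hj
  have hex : ∃ q : X × X, Γ.dist q.1 q.2 = h := ⟨(x, y), hxy⟩
  rw [intersectionNumber, dif_pos hex, hp x y hxy, hp _ _ hex.choose_spec]

/-- `c_i = p^i_{1,i-1}`, for `1 ≤ i ≤ D`. -/
noncomputable def drgC (Γ : SimpleGraph X) (i : ℕ) : ℕ := Γ.intersectionNumber i 1 (i - 1)

/-- `a_i = p^i_{1,i}`, for `0 ≤ i ≤ D`. -/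
noncomputable def drgA (Γ : SimpleGraph X) (i : ℕ) : ℕ := Γ.intersectionNumber i 1 i

/-- `b_i = p^i_{1,i+1}`, for `0 ≤ i ≤ D - 1`. -/
noncomputable def drgB (Γ : SimpleGraph X) (i : ℕ) : ℕ := Γ.intersectionNumber i 1 (i + 1)

/-- The Gaussian coefficient `[j choose 1] = 1 + q + ⋯ + q^(j-1)` with base `q`. -/
def gaussOne (q : ℝ) (j : ℕ) : ℝ := ∑ k ∈ Finset.range j, q ^ k

/-- The intersection numbers of `Γ`, of diameter `D`, are given by the classical parameters
`(D, q, α, β)`. -/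
def HasClassicalParameters (Γ : SimpleGraph X) (D : ℕ) (q α β : ℝ) : Prop :=
  Γ.IsDistanceRegular ∧ Γ.diam = D ∧
    (∀ i : ℕ, 1 ≤ i → i ≤ D →
      (Γ.drgC i : ℝ) = gaussOne q i * (1 + α * gaussOne q (i - 1))) ∧
    (∀ i : ℕ, i + 1 ≤ D →
      (Γ.drgB i : ℝ) = (gaussOne q D - gaussOne q i) * (β - α * gaussOne q i))

/-- `Γ` is of negative type: it has classical parameters `(D, q, α, β)` with `q < -1`. -/
def IsOfNegativeType (Γ : SimpleGraph X) : Prop :=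
  ∃ q α β : ℝ, q < -1 ∧ Γ.HasClassicalParameters Γ.diam q α β

/-- The complete multipartite graph `K_{1,1,2}`. -/
def K112 : SimpleGraph (Σ i : Fin 3, Fin (![1, 1, 2] i)) :=
  completeMultipartiteGraph fun i : Fin 3 => Fin (![1, 1, 2] i)

/-- A distance-regular graph of diameter `D` is a near polygon if `a_i = a_1 c_i` for
`1 ≤ i ≤ D - 1` and it has no induced subgraph `K_{1,1,2}`. -/
def IsNearPolygon (Γ : SimpleGraph X) : Prop :=
  Γ.IsDistanceRegular ∧
    (∀ i : ℕ, 1 ≤ i → i + 1 ≤ Γ.diam → Γ.drgA i = Γ.drgA 1 * Γ.drgC i) ∧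
    ¬ K112.IsIndContained Γ

end DistanceRegular

/-! ### Uniform structures -/

section Uniform

variable {X : Type*} [Fintype X]

/-- The eccentricity `ε(x)` of a vertex (a natural number; meaningful for finite connected
graphs). -/
noncomputable def eccNat (Γ : SimpleGraph X) (x : X) : ℕ := (Γ.eccent x).toNat

open Classical in
/-- The `i`-th dual idempotent `E*_i` with respect to `x`: the diagonal matrix with `(y, y)`-entry
`1` if `∂(x, y) = i` and `0` otherwise. -/
noncomputable def dualIdempotent (Γ : SimpleGraph X) (x : X) (i : ℕ) : Matrix X X ℂ :=
  Matrix.diagonal fun y => if Γ.dist x y = i then 1 else 0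

open Classical in
/-- The lowering matrix `L = ∑_{i=1}^{ε} E*_{i-1} A E*_i` with respect to `x`. -/
noncomputable def loweringMatrix (Γ : SimpleGraph X) (x : X) : Matrix X X ℂ :=
  ∑ i ∈ Finset.Icc 1 (Γ.eccNat x),
    Γ.dualIdempotent x (i - 1) * Γ.adjMatrix ℂ * Γ.dualIdempotent x i

open Classical in
/-- The raising matrix `R = ∑_{i=0}^{ε-1} E*_{i+1} A E*_i` with respect to `x`. -/
noncomputable def raisingMatrix (Γ : SimpleGraph X) (x : X) : Matrix X X ℂ :=
  ∑ i ∈ Finset.range (Γ.eccNat x),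
    Γ.dualIdempotent x (i + 1) * Γ.adjMatrix ℂ * Γ.dualIdempotent x i

/-- `U = (e_{ij})_{1 ≤ i, j ≤ n}` is a parameter matrix. Only the entries of `U` with indices in
`{1, …, n}` are used. -/
structure IsParameterMatrix (n : ℕ) (U : Matrix ℕ ℕ ℂ) : Prop where
  tridiagonal : ∀ i ∈ Finset.Icc 1 n, ∀ j ∈ Finset.Icc 1 n, (i + 1 < j ∨ j + 1 < i) → U i j = 0
  diag : ∀ i ∈ Finset.Icc 1 n, U i i = 1
  offDiag : (∀ i ∈ Finset.Icc 2 n, U i (i - 1) ≠ 0) ∨ (∀ i ∈ Finset.Icc 2 n, U (i - 1) i ≠ 0)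
  nonsingular : ∀ s t : ℕ, 1 ≤ s → s ≤ t → t ≤ n →
    (U.submatrix (fun i : Finset.Icc s t => (i : ℕ)) (fun j : Finset.Icc s t => (j : ℕ))).det ≠ 0

/-- `e^-_i = e_{i,i-1}` for `i ≥ 2`, and `e^-_1 = 0`. -/
noncomputable def eMinus (U : Matrix ℕ ℕ ℂ) (i : ℕ) : ℂ := if 2 ≤ i then U i (i - 1) else 0

/-- `e^+_i = e_{i,i+1}` for `i ≤ n - 1`, and `e^+_n = 0`. -/
noncomputable def ePlus (n : ℕ) (U : Matrix ℕ ℕ ℂ) (i : ℕ) : ℂ :=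
  if i + 1 ≤ n then U i (i + 1) else 0

/-- `(U, f)` is a uniform structure of the (bipartite) graph `Γ` with respect to `x`: `U` is a
parameter matrix of size `ε = ε(x)`, `f = (f_1, …, f_ε)`, and
`e^-_i R L² + L R L + e^+_i L² R = f_i L` holds on `E*_i V` for `1 ≤ i ≤ ε`. -/
def IsUniformStructure (Γ : SimpleGraph X) (x : X) (U : Matrix ℕ ℕ ℂ) (f : ℕ → ℂ) : Prop :=
  IsParameterMatrix (Γ.eccNat x) U ∧
    ∀ i ∈ Finset.Icc 1 (Γ.eccNat x), ∀ v : X → ℂ,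
      let L := Γ.loweringMatrix x
      let R := Γ.raisingMatrix x
      Matrix.mulVec
          (eMinus U i • (R * (L * L)) + L * R * L + ePlus (Γ.eccNat x) U i • (L * L * R))
          (Matrix.mulVec (Γ.dualIdempotent x i) v) =
        Matrix.mulVec (f i • L) (Matrix.mulVec (Γ.dualIdempotent x i) v)

/-- `Γ` admits a uniform structure with respect to `x`. -/
def HasUniformStructure (Γ : SimpleGraph X) (x : X) : Prop :=
  ∃ (U : Matrix ℕ ℕ ℂ) (f : ℕ → ℂ), Γ.IsUniformStructure x U f

/-- The graph `Γ_f = Γ_f(x)`: delete from `Γ` every edge `yz` with `∂(x, y) = ∂(x, z)`. -/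
def flatDeleted (Γ : SimpleGraph X) (x : X) : SimpleGraph X where
  Adj y z := Γ.Adj y z ∧ Γ.dist x y ≠ Γ.dist x z
  symm := ⟨fun _ _ h => ⟨h.1.symm, h.2.symm⟩⟩
  loopless := ⟨fun _ h => h.2 rfl⟩

/-- `Γ` supports a uniform structure with respect to `x` if `Γ_f(x)` admits one. -/
def SupportsUniformStructure (Γ : SimpleGraph X) (x : X) : Prop :=
  (Γ.flatDeleted x).HasUniformStructure x

end Uniform

end SimpleGraph

open Finset

namespace SimpleGraph

/-! Only the relation at level i = 2 is needed. Negative q makes Γ locally a disjoint union of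
cliques, and this local structure contradicts the relation.

Geometry. For a suitable η the matrix F with entries η + q^{-∂(y,z)} satisfies F² = cF with c > 0,
so uᵀFu is a positive multiple of |Fu|². For each pair y, z let u be the indicator of Γ_1(y) ∩
Γ_2(z) minus that of Γ_2(y) ∩ Γ_1(z), minus a suitable multiple of the indicator of y minus that of
z. The sum of uᵀFu over all pairs can be written in intersection numbers, and it is 0; hence every
Fu = 0. This is the balanced set condition (`HasClassicalParameters.balanced`). Applied to a path of
length three it says q·K = M for two cardinalities K, M, and q < 0 forces K = M = 0. So kites of
length three, and then of length two, are absent.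

Algebra. Consequently LR acts on functions on Γ(x) through the identity, the all-ones matrix and the
clique matrix, and a difference v of two clique indicators satisfies Lv = 0 and LRv = θv. If e_2^+ ≠
0, the relation and the adjointness of L and R force LR²v to be a multiple of Rv
(`exists_lowering_raising_sq_eq_smul`). Fix z at distance two from x. Take one clique having a
vertex at distance two from z and no neighbor of z; it exists because otherwise a_2 = a_1c_2, and Γ
would be a near polygon. Take the other clique through a vertex at distance three from z. Then Rv
vanishes at z and LR²v does not. If e_2^+ = 0, then e_2^- ≠ 0, and comparing two entries of the
column of z, which needs a_1 ≠ 0, gives c_2 = 1 and then e_2^- = 0. -/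

/-- The intersection number `c_i` prescribed by classical parameters. -/
noncomputable def classicalC (q α : ℝ) (i : ℕ) : ℝ :=
  gaussOne q i * (1 + α * gaussOne q (i - 1))

/-- The intersection number `b_i` prescribed by classical parameters. -/
noncomputable def classicalB (D : ℕ) (q α β : ℝ) (i : ℕ) : ℝ :=
  (gaussOne q D - gaussOne q i) * (β - α * gaussOne q i)

/-- The intersection number `a_i` prescribed by classical parameters. -/
noncomputable def classicalA (D : ℕ) (q α β : ℝ) (i : ℕ) : ℝ :=
  classicalB D q α β 0 - classicalB D q α β i - classicalC q α i

/-! ### Counting neighbors by distance. -/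

section Counting

variable {X : Type*} [Fintype X] {Γ : SimpleGraph X}

theorem IsDistanceRegular.dist_le_diam (hΓ : Γ.IsDistanceRegular) (x y : X) :
    Γ.dist x y ≤ Γ.diam := by
  have : Nonempty X := ⟨x⟩
  exact SimpleGraph.dist_le_diam (connected_iff_ediam_ne_top.1 hΓ.1)

omit [Fintype X] in
theorem Connected.dist_cases_of_dist_eq_one (hc : Γ.Connected) {x z : X} (y : X)
    (h : Γ.dist x z = 1) :
    Γ.dist z y + 1 = Γ.dist x y ∨ Γ.dist z y = Γ.dist x y ∨ Γ.dist z y = Γ.dist x y + 1 := by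
  have h1 := hc.dist_triangle (u := x) (v := z) (w := y)
  have h2 := hc.dist_triangle (u := z) (v := x) (w := y)
  rw [dist_comm (u := z) (v := x)] at h2
  omega

theorem HasClassicalParameters.card_dist_pred {D : ℕ} {q α β : ℝ}
    (h : Γ.HasClassicalParameters D q α β) (x y : X) :
    ((univ.filter fun z => Γ.dist x z = 1 ∧ Γ.dist z y + 1 = Γ.dist x y).card : ℝ) =
      classicalC q α (Γ.dist x y) := by
  obtain ⟨hr, rfl, hc, -⟩ := h
  rcases Nat.eq_zero_or_pos (Γ.dist x y) with h0 | h0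
  -- The formula for c_i also holds at i = 0, since the empty Gaussian sum is 0.
  · simp [h0, classicalC, gaussOne]
  · have hD := hr.dist_le_diam x y
    rw [classicalC, ← hc _ h0 hD, drgC,
      ← hr.sphereInterCard_eq hD (by omega) (by omega) rfl, sphereInterCard]
    congr 2
    ext z
    simp only [mem_filter, mem_univ, true_and, dist_comm (u := y)]
    omega

theorem HasClassicalParameters.card_dist_succ {D : ℕ} {q α β : ℝ}
    (h : Γ.HasClassicalParameters D q α β) (x y : X) :
    ((univ.filter fun z => Γ.dist x z = 1 ∧ Γ.dist z y = Γ.dist x y + 1).card : ℝ) =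
      classicalB D q α β (Γ.dist x y) := by
  obtain ⟨hr, rfl, -, hb⟩ := h
  have hD := hr.dist_le_diam x y
  -- At distance D the set is empty, and the formula for b_i vanishes at i = D.
  rcases hD.eq_or_lt with h0 | h0
  · have : (univ.filter fun z => Γ.dist x z = 1 ∧ Γ.dist z y = Γ.dist x y + 1) = ∅ := by
      ext z
      have := hr.dist_le_diam z y
      simp only [mem_filter, mem_univ, true_and, notMem_empty, iff_false]
      omega
    rw [this, h0]
    simp [classicalB]
  · rw [classicalB, ← hb _ h0, drgB,
      ← hr.sphereInterCard_eq hD (by omega) (by omega) rfl, sphereInterCard]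
    congr 2
    ext z
    simp only [mem_filter, mem_univ, true_and, dist_comm (u := y)]

theorem HasClassicalParameters.card_dist_one {D : ℕ} {q α β : ℝ}
    (h : Γ.HasClassicalParameters D q α β) (x : X) :
    ((univ.filter fun z => Γ.dist x z = 1).card : ℝ) = classicalB D q α β 0 := by
  have := h.card_dist_succ x x
  rw [dist_self] at this
  rw [← this]
  congr 2
  ext z
  simp [dist_comm (u := z)]

theorem HasClassicalParameters.card_dist_eq {D : ℕ} {q α β : ℝ}
    (h : Γ.HasClassicalParameters D q α β) (x y : X) :
    ((univ.filter fun z => Γ.dist x z = 1 ∧ Γ.dist z y = Γ.dist x y).card : ℝ) =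
      classicalA D q α β (Γ.dist x y) := by
  rw [classicalA, ← h.card_dist_one x, ← h.card_dist_succ x y, ← h.card_dist_pred x y]
  simp only [card_filter, Nat.cast_sum, ← sum_sub_distrib]
  refine sum_congr rfl fun z _ => ?_
  by_cases hz : Γ.dist x z = 1
  · rcases h.1.1.dist_cases_of_dist_eq_one y hz with h' | h' | h'
    · have h1 : Γ.dist z y ≠ Γ.dist x y := by omega
      have h2 : Γ.dist z y ≠ Γ.dist x y + 1 := by omega
      simp [hz, h', h1, h2]
    · simp [hz, h']
    · have h1 : Γ.dist x y + 1 + 1 ≠ Γ.dist x y := by omega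
      simp [hz, h', h1]
  · simp [hz]

/-- The distance-`i` matrix. -/
noncomputable def distMat (Γ : SimpleGraph X) (i : ℕ) : Matrix X X ℝ :=
  Matrix.of fun x y => if Γ.dist x y = i then 1 else 0

omit [Fintype X] in
theorem distMat_apply (i : ℕ) (x y : X) :
    Γ.distMat i x y = if Γ.dist x y = i then 1 else 0 := rfl

omit [Fintype X] in
theorem distMat_comm (i : ℕ) (x y : X) : Γ.distMat i x y = Γ.distMat i y x := by
  simp [distMat_apply, dist_comm]

/-- The neighbors of x split into three classes by their distance to y. The truncated index at
distance 0 is harmless because c_0 = 0. -/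
theorem HasClassicalParameters.sum_neighbor {D : ℕ} {q α β : ℝ}
    (h : Γ.HasClassicalParameters D q α β) (f : ℕ → ℝ) (x y : X) :
    ∑ z, Γ.distMat 1 x z * f (Γ.dist z y) =
      classicalC q α (Γ.dist x y) * f (Γ.dist x y - 1) +
      classicalA D q α β (Γ.dist x y) * f (Γ.dist x y) +
      classicalB D q α β (Γ.dist x y) * f (Γ.dist x y + 1) := by
  rw [← h.card_dist_succ x y, ← h.card_dist_pred x y, ← h.card_dist_eq x y]
  simp only [card_filter, Nat.cast_sum, sum_mul, ← sum_add_distrib]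
  refine sum_congr rfl fun z _ => ?_
  by_cases hz : Γ.dist x z = 1
  · rcases h.1.1.dist_cases_of_dist_eq_one y hz with h' | h' | h'
    · have h1 : Γ.dist z y ≠ Γ.dist x y := by omega
      have h2 : Γ.dist z y ≠ Γ.dist x y + 1 := by omega
      have h3 : Γ.dist x y - 1 = Γ.dist z y := by omega
      simp [distMat_apply, hz, h', h1, h2, h3]
    · simp [distMat_apply, hz, h']
    · have h1 : Γ.dist x y + 1 + 1 ≠ Γ.dist x y := by omega
      simp [distMat_apply, hz, h', h1]
  · simp [distMat_apply, hz]

theorem HasClassicalParameters.distMat_one_mul {D : ℕ} {q α β : ℝ}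
    (h : Γ.HasClassicalParameters D q α β) (i : ℕ) :
    Γ.distMat 1 * Γ.distMat (i + 1) = classicalB D q α β i • Γ.distMat i +
      classicalA D q α β (i + 1) • Γ.distMat (i + 1) +
      classicalC q α (i + 2) • Γ.distMat (i + 2) := by
  ext x y
  have := h.sum_neighbor (fun j => if j = i + 1 then 1 else 0) x y
  simp only [Matrix.mul_apply, Matrix.add_apply, Matrix.smul_apply, smul_eq_mul]
  simp only [distMat_apply] at this ⊢
  rw [this]
  rcases h0 : Γ.dist x y with _ | m
  · rcases i with _ | i <;> simp
  · rw [Nat.add_sub_cancel]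
    by_cases h1 : m = i + 1
    · subst h1; simp [add_assoc]
    · by_cases h2 : m = i
      · subst h2; simp
      · by_cases h3 : m + 1 = i
        · subst h3; simp [h1]
        · simp [h1, h2, h3]

theorem gaussOne_zero (q : ℝ) : gaussOne q 0 = 0 := by simp [gaussOne]
theorem gaussOne_one (q : ℝ) : gaussOne q 1 = 1 := by simp [gaussOne]
theorem gaussOne_two (q : ℝ) : gaussOne q 2 = 1 + q := by simp [gaussOne, sum_range_succ]
theorem gaussOne_three (q : ℝ) : gaussOne q 3 = 1 + q + q ^ 2 := by
  simp [gaussOne, sum_range_succ]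

theorem gaussOne_succ (q : ℝ) (i : ℕ) : gaussOne q (i + 1) = 1 + q * gaussOne q i := by
  rw [gaussOne, sum_range_succ', gaussOne, mul_sum, add_comm]
  simp [pow_succ']

theorem gaussOne_mul_sub_one (q : ℝ) (i : ℕ) : gaussOne q i * (q - 1) = q ^ i - 1 :=
  geom_sum_mul q i

/-! ### Vertices at prescribed distances -/

omit [Fintype X] in
theorem Connected.exists_dist_eq (hc : Γ.Connected) {x y : X} {i : ℕ} (hi : i ≤ Γ.dist x y) :
    ∃ z, Γ.dist x z = i ∧ Γ.dist z y + i = Γ.dist x y := by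
  obtain ⟨p, hp⟩ := hc.exists_walk_length_eq_dist x y
  refine ⟨p.getVert i, ?_⟩
  have h1 : Γ.dist x (p.getVert i) ≤ i := by
    refine (dist_le (p.take i)).trans ?_
    simp [Walk.take_length]
  have h2 : Γ.dist (p.getVert i) y ≤ Γ.dist x y - i := by
    refine (dist_le (p.drop i)).trans ?_
    simp [Walk.drop_length, hp]
  have h3 := hc.dist_triangle (u := x) (v := p.getVert i) (w := y)
  omega

theorem IsDistanceRegular.exists_dist_eq (hr : Γ.IsDistanceRegular) (x : X) {i : ℕ}
    (hi : i ≤ Γ.diam) : ∃ y, Γ.dist x y = i := by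
  classical
  have : Nonempty X := ⟨x⟩
  obtain ⟨u, v, huv⟩ := Γ.exists_dist_eq_diam
  obtain ⟨w, hw, -⟩ := hr.1.exists_dist_eq (x := u) (y := v) (i := i) (by omega)
  have h1 := hr.sphereInterCard_eq (Nat.zero_le _) hi hi (x := u) (y := u) dist_self
  have h2 := hr.sphereInterCard_eq (Nat.zero_le _) hi hi (x := x) (y := x) dist_self
  rw [← h2] at h1
  simp only [sphereInterCard] at h1
  have : 0 < (univ.filter fun z : X => Γ.dist x z = i ∧ Γ.dist x z = i).card := by
    rw [← h1]
    exact card_pos.2 ⟨w, by simp [hw]⟩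
  obtain ⟨y, hy⟩ := card_pos.1 this
  exact ⟨y, by simpa using hy⟩

/-- Positivity of b_i: some vertex on a geodesic of length i + 1 from x witnesses it, and the count
depends only on the distance. -/
theorem IsDistanceRegular.exists_dist_succ (hr : Γ.IsDistanceRegular) {x y : X} {i : ℕ}
    (hxy : Γ.dist x y = i) (hi : i + 1 ≤ Γ.diam) :
    ∃ z, Γ.dist y z = 1 ∧ Γ.dist x z = i + 1 := by
  obtain ⟨w, hw⟩ := hr.exists_dist_eq x hi
  obtain ⟨v, hv, hv'⟩ := hr.1.exists_dist_eq (x := x) (y := w) (i := i) (by omega)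
  have h1 := hr.sphereInterCard_eq (h := i) (i := 1) (j := i + 1) (by omega) (by omega) hi
    (x := v) (y := x) (by rw [dist_comm, hv])
  have h2 := hr.sphereInterCard_eq (h := i) (i := 1) (j := i + 1) (by omega) (by omega) hi
    (x := y) (y := x) (by rw [dist_comm, hxy])
  rw [← h2] at h1
  simp only [sphereInterCard] at h1
  have : 0 < (univ.filter fun z : X => Γ.dist y z = 1 ∧ Γ.dist x z = i + 1).card := by
    rw [← h1]
    refine card_pos.2 ⟨w, ?_⟩
    simp only [mem_filter, mem_univ, true_and]
    omega
  obtain ⟨z, hz⟩ := card_pos.1 this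
  exact ⟨z, by simpa using hz⟩

theorem HasClassicalParameters.classicalB_ne_zero {D : ℕ} {q α β : ℝ}
    (h : Γ.HasClassicalParameters D q α β) {x : X} {i : ℕ} (hi : i + 1 ≤ D) :
    classicalB D q α β i ≠ 0 := by
  obtain ⟨y, hy⟩ := h.1.exists_dist_eq x (i := i) (by rw [h.2.1]; omega)
  obtain ⟨z, hz, hz'⟩ := h.1.exists_dist_succ hy (by rw [h.2.1]; omega)
  have := h.card_dist_succ y x
  rw [dist_comm, hy] at this
  rw [← this, Nat.cast_ne_zero]
  refine (card_pos.2 ⟨z, ?_⟩).ne'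
  simp only [mem_filter, mem_univ, true_and, dist_comm (u := z)]
  exact ⟨hz, hz'⟩

theorem HasClassicalParameters.classicalC_pos {D : ℕ} {q α β : ℝ}
    (h : Γ.HasClassicalParameters D q α β) {x : X} {i : ℕ} (hi : i + 1 ≤ D) :
    0 < classicalC q α (i + 1) := by
  obtain ⟨y, hy⟩ := h.1.exists_dist_eq x (i := i + 1) (by rw [h.2.1]; omega)
  obtain ⟨z, hz, hz'⟩ := h.1.1.exists_dist_eq (x := y) (y := x) (i := 1)
    (by rw [dist_comm, hy]; omega)
  have := h.card_dist_pred y x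
  rw [dist_comm, hy] at this
  rw [← this, Nat.cast_pos]
  refine card_pos.2 ⟨z, ?_⟩
  rw [dist_comm (u := y), hy] at hz'
  simp only [mem_filter, mem_univ, true_and]
  exact ⟨hz, hz'⟩

end Counting

/-! ### The dual eigenvalue sequence and its idempotent. -/

section Cosine

variable {X : Type*} [Fintype X] {Γ : SimpleGraph X}

/-- The dual eigenvalue sequence `η + q ^ (-i)`. -/
noncomputable def dualEigenvalue (η q : ℝ) (i : ℕ) : ℝ := η + (q ^ i)⁻¹

/-- An affine function of q^{-i} is an eigenvector of the tridiagonal intersection matrix; this is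
the Q-polynomial structure carried by classical parameters. -/
theorem HasClassicalParameters.exists_dualEigenvalue_recurrence {D : ℕ} {q α β : ℝ}
    (h : Γ.HasClassicalParameters D q α β) (hq : q < -1) (hD : 2 ≤ D) (x : X) :
    ∃ η θ : ℝ, 0 < dualEigenvalue η q 0 ∧ ∀ i,
      classicalC q α i * dualEigenvalue η q (i - 1) +
        classicalA D q α β i * dualEigenvalue η q i +
        classicalB D q α β i * dualEigenvalue η q (i + 1) = θ * dualEigenvalue η q i := by
  have hq0 : q ≠ 0 := by linarith
  have hq1 : q - 1 ≠ 0 := by linarith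
  have hpos : ∀ i, i + 1 ≤ D → 0 < classicalB D q α β i := fun i hi => by
    refine lt_of_le_of_ne ?_ (h.classicalB_ne_zero (x := x) hi).symm
    obtain ⟨y, hy⟩ := h.1.exists_dist_eq x (i := i) (by rw [h.2.1]; omega)
    rw [← hy, ← h.card_dist_succ]
    positivity
  have hb0 := hpos 0 (by omega)
  have hb1 := hpos 1 (by omega)
  set k := classicalB D q α β 0 with hk
  set b1 := classicalB D q α β 1 with hb1'
  have hlt : 0 < k - (b1 / q - 1) := by
    have : b1 / q < 0 := div_neg_of_pos_of_neg hb1 (by linarith)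
    linarith
  have hnum : 0 < (q - 1) / q := div_pos_of_neg_of_neg (by linarith) (by linarith)
  -- The eigenvalue is θ = b_1/q - 1. The row i = 0, k(η + 1/q) = θ(η + 1), determines η, so that η
  -- + 1 = (1 - 1/q)k/(k - θ), which is positive since q < 0.
  refine ⟨(q - 1) / q * k / (k - (b1 / q - 1)) - 1, b1 / q - 1, ?_, fun i => ?_⟩
  · simp only [dualEigenvalue, pow_zero, inv_one, sub_add_cancel]
    positivity
  -- With a_i = k - b_i - c_i the recurrence involves only differences of consecutive terms, and
  -- those are multiples of powers of q.
  · have key : (b1 / q - 1 - k) * dualEigenvalue ((q - 1) / q * k / (k - (b1 / q - 1)) - 1) q i =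
        (q - 1) * (q ^ i)⁻¹ * classicalC q α i -
          (q - 1) * (q ^ (i + 1))⁻¹ * classicalB D q α β i := by
      have e1 : (b1 / q - 1 - k) *
          dualEigenvalue ((q - 1) / q * k / (k - (b1 / q - 1)) - 1) q i =
          -((q - 1) / q * k) + (b1 / q - 1 - k) * ((q ^ i)⁻¹ - 1) := by
        have hw := div_mul_cancel₀ ((q - 1) / q * k) hlt.ne'
        rw [dualEigenvalue]
        generalize (q - 1) / q * k / (k - (b1 / q - 1)) = w at *
        linear_combination -hw
      rw [e1]
      have hg : ∀ j, gaussOne q j = (q ^ j - 1) / (q - 1) := fun j => by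
        rw [eq_div_iff hq1, gaussOne_mul_sub_one]
      rcases i with _ | i
      · have hc0 : classicalC q α 0 = 0 := by simp [classicalC, gaussOne_zero]
        rw [hc0, ← hk]
        simp only [pow_zero, zero_add, pow_one]
        ring
      · rw [hk, hb1']
        simp only [classicalB, classicalC, Nat.add_sub_cancel, hg]
        have hx : q ^ i ≠ 0 := pow_ne_zero _ hq0
        simp only [pow_succ, pow_zero]
        generalize q ^ i = t at *
        field_simp
        ring
    rcases i with _ | i
    · have hc0 : classicalC q α 0 = 0 := by simp [classicalC, gaussOne_zero]
      rw [classicalA, hc0]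
      rw [hc0] at key
      simp only [dualEigenvalue] at key ⊢
      simp only [zero_add, pow_zero, pow_one, inv_one, ← hk] at key ⊢
      have : (q - 1) * q⁻¹ = 1 - q⁻¹ := by field_simp
      rw [this] at key
      linear_combination -key
    · rw [classicalA, Nat.add_sub_cancel]
      simp only [dualEigenvalue] at key ⊢
      have e1 : (q - 1) * (q ^ (i + 1))⁻¹ = (q ^ i)⁻¹ - (q ^ (i + 1))⁻¹ := by
        field_simp
        ring
      have e2 : (q - 1) * (q ^ (i + 1 + 1))⁻¹ = (q ^ (i + 1))⁻¹ - (q ^ (i + 1 + 1))⁻¹ := by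
        field_simp
        ring
      rw [e1, e2] at key
      linear_combination -key

/-- Closure of the Bose–Mesner algebra under multiplication. -/
theorem IsDistanceRegular.exists_conv_eq (hr : Γ.IsDistanceRegular) (f g : ℕ → ℝ) :
    ∃ Φ : ℕ → ℝ, ∀ x y, ∑ s, f (Γ.dist x s) * g (Γ.dist s y) = Φ (Γ.dist x y) := by
  classical
  have : ∀ n, ∃ p : ℝ, ∀ x y, Γ.dist x y = n →
      ∑ s, f (Γ.dist x s) * g (Γ.dist s y) = p := fun n => by
    refine ⟨∑ i ∈ range (Γ.diam + 1), ∑ j ∈ range (Γ.diam + 1),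
      f i * g j * (Γ.intersectionNumber n i j : ℝ), fun x y hxy => ?_⟩
    have h1 : ∀ i ∈ range (Γ.diam + 1), ∀ j ∈ range (Γ.diam + 1),
        f i * g j * (Γ.intersectionNumber n i j : ℝ) =
        ∑ s, if Γ.dist x s = i then if Γ.dist y s = j then f i * g j else 0 else 0 := by
      intro i hi j hj
      rw [mem_range] at hi hj
      rw [← hr.sphereInterCard_eq (hxy ▸ hr.dist_le_diam x y) (by omega) (by omega) hxy,
        sphereInterCard, card_filter, Nat.cast_sum, mul_sum]
      refine sum_congr rfl fun s _ => ?_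
      split_ifs <;> simp_all
    rw [sum_congr rfl fun i hi => sum_congr rfl fun j hj => h1 i hi j hj]
    have h2 : ∀ i ∈ range (Γ.diam + 1), ∑ j ∈ range (Γ.diam + 1),
        ∑ s, (if Γ.dist x s = i then if Γ.dist y s = j then f i * g j else 0 else 0) =
        ∑ s, if Γ.dist x s = i then f i * g (Γ.dist s y) else 0 := fun i _ => by
      rw [sum_comm]
      refine sum_congr rfl fun s _ => ?_
      split_ifs
      · rw [sum_ite_eq, if_pos, dist_comm]
        have := hr.dist_le_diam y s
        rw [mem_range]; omega
      · simp
    rw [sum_congr rfl h2, sum_comm]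
    refine sum_congr rfl fun s _ => ?_
    rw [sum_ite_eq, if_pos]
    have := hr.dist_le_diam x s
    rw [mem_range]; omega
  choose Φ hΦ using this
  exact ⟨Φ, fun x y => hΦ _ x y rfl⟩

/-- The convolution square obeys the same three-term recurrence as f, whose solutions on 0, …, D are
determined by the initial value because b_i ≠ 0. The constant is positive since the square at
distance 0 is a sum of squares. -/
theorem HasClassicalParameters.exists_conv_eq_mul {D : ℕ} {q α β : ℝ}
    (h : Γ.HasClassicalParameters D q α β) (x : X) {f : ℕ → ℝ} {θ : ℝ} (h0 : 0 < f 0)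
    (hf : ∀ i, classicalC q α i * f (i - 1) + classicalA D q α β i * f i +
      classicalB D q α β i * f (i + 1) = θ * f i) :
    ∃ c : ℝ, 0 < c ∧ ∀ y z, ∑ s, f (Γ.dist y s) * f (Γ.dist s z) = c * f (Γ.dist y z) := by
  obtain ⟨Φ, hΦ⟩ := h.1.exists_conv_eq f f
  have rec' : ∀ n, n ≤ D → classicalC q α n * Φ (n - 1) + classicalA D q α β n * Φ n +
      classicalB D q α β n * Φ (n + 1) = θ * Φ n := by
    intro n hn
    obtain ⟨y, rfl⟩ := h.1.exists_dist_eq x (i := n) (by rw [h.2.1]; omega)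
    rw [← h.sum_neighbor Φ x y, ← hΦ]
    simp only [← hΦ, mul_sum]
    rw [sum_comm]
    refine sum_congr rfl fun t _ => ?_
    have e := h.sum_neighbor f x t
    rw [hf] at e
    rw [← mul_assoc, ← e, sum_mul]
    exact sum_congr rfl fun s _ => by ring
  have prop : ∀ n, n ≤ D → Φ n * f 0 = Φ 0 * f n := by
    intro n
    induction n using Nat.strong_induction_on with
    | _ n ih =>
      intro hn
      rcases n with _ | n
      · rfl
      · have i1 := ih n (by omega) (by omega)
        have i2 := ih (n - 1) (by omega) (by omega)
        have r1 := rec' n (by omega)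
        have r2 := hf n
        have hb := h.classicalB_ne_zero (x := x) hn
        apply mul_left_cancel₀ hb
        linear_combination f 0 * r1 - Φ 0 * r2 - classicalC q α n * i2 -
          classicalA D q α β n * i1 + θ * i1
  refine ⟨Φ 0 / f 0, div_pos ?_ h0, fun y z => ?_⟩
  · have := hΦ x x
    rw [dist_self] at this
    rw [← this]
    refine sum_pos' (fun s _ => ?_) ⟨x, mem_univ _, ?_⟩
    · rw [dist_comm (u := s)]
      exact mul_self_nonneg _
    · rw [dist_self]
      exact mul_pos h0 h0
  · rw [hΦ, div_mul_eq_mul_div, eq_div_iff h0.ne']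
    exact prop _ (by rw [← h.2.1]; exact h.1.dist_le_diam y z)

end Cosine

/-! ### A quadratic form summed over all pairs of vertices. -/

section Quadratic

variable {X : Type*} [Fintype X] [DecidableEq X]

theorem sum_sum_mul_sub_ite (F : Matrix X X ℝ) (a b : X → ℝ) (r s : ℝ) (y t : X) :
    ∑ w, ∑ w', F w w' * ((a w - if w = y then r else 0) * (b w' - if w' = t then s else 0)) =
      ∑ w, ∑ w', F w w' * (a w * b w') - s * ∑ w, F w t * a w - r * ∑ w', F y w' * b w' +
        r * s * F y t := by
  have e : ∀ w w', F w w' * ((a w - if w = y then r else 0) * (b w' - if w' = t then s else 0)) =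
      F w w' * (a w * b w') - (if w' = t then s * (F w t * a w) else 0) -
        (if w = y then r * (F y w' * b w') else 0) +
        if w = y then if w' = t then r * s * F y t else 0 else 0 := fun w w' => by
    split_ifs <;> subst_vars <;> ring
  simp only [e, sum_add_distrib, sum_sub_distrib, sum_ite_eq', mem_univ, if_true, mul_sum]
  congr 1
  · congr 1
    rw [sum_comm]
    simp
  · rw [sum_comm]
    simp

omit [DecidableEq X] in
theorem sum_comm_pairs (f : X → X → X → X → ℝ) :
    ∑ y, ∑ z, ∑ w, ∑ w', f y z w w' = ∑ w, ∑ w', ∑ y, ∑ z, f y z w w' := by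
  calc ∑ y, ∑ z, ∑ w, ∑ w', f y z w w' = ∑ y, ∑ w, ∑ z, ∑ w', f y z w w' :=
        sum_congr rfl fun y _ => sum_comm
    _ = ∑ w, ∑ y, ∑ z, ∑ w', f y z w w' := sum_comm
    _ = ∑ w, ∑ y, ∑ w', ∑ z, f y z w w' :=
        sum_congr rfl fun w _ => sum_congr rfl fun y _ => sum_comm
    _ = _ := sum_congr rfl fun w _ => sum_comm

/-- Each vector has the form g(y,z) - g(z,y), so swapping y and z produces the factor 2. The sums
over y, z of the remaining products collapse to entries of A², B² and AB. -/
theorem sum_quadratic_commutator {A B R F : Matrix X X ℝ} {f₀ f₁ f₂ : ℝ}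
    (hA : ∀ y z, A y z = A z y) (hB : ∀ y z, B y z = B z y) (hR : ∀ y z, R y z = R z y)
    (hF : ∀ y z, F y z = F z y) (hAB : A * B = B * A) (hf₀ : ∀ y, F y y = f₀)
    (hf₁ : ∀ y z, F y z * A y z = f₁ * A y z) (hf₂ : ∀ y z, F y z * B y z = f₂ * B y z) :
    ∑ y, ∑ z, ∑ w, ∑ w', F w w' *
      ((A y w * B w z - B y w * A w z - R y z * ((if w = y then 1 else 0) - if w = z then 1 else 0)) *
      (A y w' * B w' z - B y w' * A w' z -
        R y z * ((if w' = y then 1 else 0) - if w' = z then 1 else 0))) =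
    2 * ∑ y, ∑ z, (F y z * ((A * A) y z * (B * B) y z) - F y z * (A * B) y z ^ 2 +
      (f₀ - F y z) * R y z ^ 2 - 2 * (f₁ - f₂) * ((A * B) y z * R y z)) := by
  set g : X → X → X → ℝ := fun y z w => A y w * B w z - if w = y then R y z else 0 with hg
  have hu : ∀ y z w, A y w * B w z - B y w * A w z -
      R y z * ((if w = y then 1 else 0) - if w = z then 1 else 0) = g y z w - g z y w := by
    intro y z w
    simp only [hg]
    rw [hR z y, hA z w, hB w y]
    split_ifs <;> ring
  simp only [hu]
  have hexp : ∀ y z, ∑ w, ∑ w', F w w' * ((g y z w - g z y w) * (g y z w' - g z y w')) =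
      (∑ w, ∑ w', F w w' * (g y z w * g y z w') - ∑ w, ∑ w', F w w' * (g y z w * g z y w')) +
      (∑ w, ∑ w', F w w' * (g z y w * g z y w') -
        ∑ w, ∑ w', F w w' * (g z y w * g y z w')) := by
    intro y z
    simp only [← sum_sub_distrib, ← sum_add_distrib]
    exact sum_congr rfl fun w _ => sum_congr rfl fun w' _ => by ring
  simp only [hexp, sum_add_distrib]
  rw [sum_comm (f := fun y z => ∑ w, ∑ w', F w w' * (g z y w * g z y w') -
        ∑ w, ∑ w', F w w' * (g z y w * g y z w')), ← two_mul]
  congr 1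
  have hAsq : ∀ w w', (A * A) w w' = ∑ y, A y w * A y w' := fun w w' => by
    rw [Matrix.mul_apply]; exact sum_congr rfl fun y _ => by rw [hA w y]
  have hBsq : ∀ w w', (B * B) w w' = ∑ y, B w y * B w' y := fun w w' => by
    rw [Matrix.mul_apply]; exact sum_congr rfl fun y _ => by rw [hB y w']
  have hBA1 : ∀ w w', (A * B) w w' = ∑ z, B w z * A z w' := fun w w' => by
    rw [hAB, Matrix.mul_apply]
  have hBA2 : ∀ w w', (A * B) w w' = ∑ y, A y w * B w' y := fun w w' => by
    rw [Matrix.mul_apply]; exact sum_congr rfl fun y _ => by rw [hA w y, hB y w']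
  have hsym : ∀ y z, (A * B) z y = (A * B) y z := fun y z => by
    rw [hBA1 z y, Matrix.mul_apply]
    exact sum_congr rfl fun w _ => by rw [hA y w, hB w z, mul_comm]
  have h1 : ∑ y, ∑ z, ∑ w, ∑ w', F w w' * ((A y w * B w z) * (A y w' * B w' z)) =
      ∑ w, ∑ w', F w w' * ((A * A) w w' * (B * B) w w') := by
    rw [sum_comm_pairs]
    refine sum_congr rfl fun w _ => sum_congr rfl fun w' _ => ?_
    rw [hAsq, hBsq, sum_mul_sum, mul_sum]
    refine sum_congr rfl fun y _ => ?_
    rw [mul_sum]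
    exact sum_congr rfl fun z _ => by ring
  have h2 : ∑ y, ∑ z, ∑ w, ∑ w', F w w' * ((A y w * B w z) * (A z w' * B w' y)) =
      ∑ w, ∑ w', F w w' * (A * B) w w' ^ 2 := by
    rw [sum_comm_pairs]
    refine sum_congr rfl fun w _ => sum_congr rfl fun w' _ => ?_
    rw [sq]
    nth_rw 1 [hBA2]
    rw [hBA1, sum_mul_sum, mul_sum]
    refine sum_congr rfl fun y _ => ?_
    rw [mul_sum]
    exact sum_congr rfl fun z _ => by ring
  have h3 : ∀ y z, ∑ w, F w y * (A y w * B w z) = f₁ * (A * B) y z := fun y z => by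
    rw [Matrix.mul_apply, mul_sum]
    refine sum_congr rfl fun w _ => ?_
    rw [hF w y, ← mul_assoc, hf₁, mul_assoc]
  have h4 : ∀ y z, ∑ w, F w z * (A y w * B w z) = f₂ * (A * B) y z := fun y z => by
    rw [Matrix.mul_apply, mul_sum]
    refine sum_congr rfl fun w _ => ?_
    linear_combination A y w * hf₂ w z
  have hP : ∀ y z, ∑ w, ∑ w', F w w' * (g y z w * g y z w') =
      ∑ w, ∑ w', F w w' * ((A y w * B w z) * (A y w' * B w' z)) -
        2 * f₁ * ((A * B) y z * R y z) + f₀ * R y z ^ 2 := fun y z => by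
    simp only [hg]
    rw [sum_sum_mul_sub_ite F (fun w => A y w * B w z) (fun w => A y w * B w z)]
    rw [h3, hf₀]
    have := h3 y z
    simp only [hF _ y] at this
    rw [this]
    ring
  have hN : ∀ y z, ∑ w, ∑ w', F w w' * (g y z w * g z y w') =
      ∑ w, ∑ w', F w w' * ((A y w * B w z) * (A z w' * B w' y)) -
        2 * f₂ * ((A * B) y z * R y z) + F y z * R y z ^ 2 := fun y z => by
    simp only [hg]
    rw [sum_sum_mul_sub_ite F (fun w => A y w * B w z) (fun w => A z w * B w y)]
    rw [h4]
    have := h4 z y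
    simp only [hF _ y] at this
    rw [this, hsym, hR z y]
    ring
  simp only [hP, hN, sum_sub_distrib, sum_add_distrib, h1, h2]
  simp only [← sum_sub_distrib, ← sum_add_distrib]
  exact sum_congr rfl fun w _ => sum_congr rfl fun w' _ => by ring

end Quadratic

/-! ### The balanced set condition. -/

section Balanced

variable {X : Type*} [Fintype X] {Γ : SimpleGraph X}

theorem HasClassicalParameters.sum_distMat_one {D : ℕ} {q α β : ℝ}
    (h : Γ.HasClassicalParameters D q α β) (x : X) :
    ∑ y, Γ.distMat 1 x y = classicalB D q α β 0 := by
  rw [← h.card_dist_one x, card_filter, Nat.cast_sum]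
  exact sum_congr rfl fun y _ => by simp [distMat_apply]

theorem HasClassicalParameters.sum_distMat_one_mul {D : ℕ} {q α β : ℝ}
    (h : Γ.HasClassicalParameters D q α β) (M : Matrix X X ℝ) :
    ∑ x, ∑ y, (Γ.distMat 1 * M) x y = classicalB D q α β 0 * ∑ x, ∑ y, M x y := by
  simp only [Matrix.mul_apply]
  rw [sum_congr rfl fun x _ => sum_comm, sum_comm, mul_sum]
  refine sum_congr rfl fun z _ => ?_
  simp only [← mul_sum]
  rw [← sum_mul, ← h.sum_distMat_one z]
  simp only [distMat_comm]

theorem HasClassicalParameters.sum_distMat_succ {D : ℕ} {q α β : ℝ}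
    (h : Γ.HasClassicalParameters D q α β) (i : ℕ) :
    classicalC q α (i + 1) * ∑ x, ∑ y, Γ.distMat (i + 1) x y =
      classicalB D q α β i * ∑ x, ∑ y, Γ.distMat i x y := by
  induction i with
  | zero =>
    have : ∀ x : X, ∑ y, Γ.distMat 0 x y = 1 := fun x => by
      classical
      simp only [distMat_apply, h.1.1.dist_eq_zero_iff]
      simp
    simp only [zero_add, h.sum_distMat_one, this, classicalC, gaussOne_one, Nat.sub_self,
      gaussOne_zero]
    simp [mul_comm]
  | succ i ih =>
    have e := h.sum_distMat_one_mul (Γ.distMat (i + 1))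
    rw [h.distMat_one_mul] at e
    simp only [Matrix.add_apply, Matrix.smul_apply, smul_eq_mul, sum_add_distrib,
      ← mul_sum] at e
    simp only [classicalA] at e
    linear_combination e + ih

theorem HasClassicalParameters.distMat_one_mul_comm {D : ℕ} {q α β : ℝ}
    (h : Γ.HasClassicalParameters D q α β) (i : ℕ) :
    Γ.distMat 1 * Γ.distMat (i + 1) = Γ.distMat (i + 1) * Γ.distMat 1 := by
  ext y z
  have e : (Γ.distMat (i + 1) * Γ.distMat 1) y z = (Γ.distMat 1 * Γ.distMat (i + 1)) z y := by
    simp only [Matrix.mul_apply]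
    exact sum_congr rfl fun w _ => by
      rw [distMat_comm (i + 1) y w, distMat_comm 1 w z, mul_comm]
  rw [e, h.distMat_one_mul]
  simp only [Matrix.add_apply, Matrix.smul_apply, distMat_comm _ y z]

/-- Since c_2A_2 is a quadratic polynomial in A_1, the square of A_2 reduces to products with A_1,
for which the three-term formula is available. -/
theorem HasClassicalParameters.classicalC_two_smul_distMat_two_sq {D : ℕ} {q α β : ℝ}
    (h : Γ.HasClassicalParameters D q α β) :
    classicalC q α 2 • (Γ.distMat 2 * Γ.distMat 2) =
      classicalB D q α β 1 • (Γ.distMat 1 * Γ.distMat 1) +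
      classicalA D q α β 2 • (Γ.distMat 1 * Γ.distMat 2) +
      classicalC q α 3 • (Γ.distMat 1 * Γ.distMat 3) - classicalB D q α β 0 • Γ.distMat 2 -
      classicalA D q α β 1 • (Γ.distMat 1 * Γ.distMat 2) := by
  classical
  have h0 : Γ.distMat 0 = 1 := by
    ext x y
    simp [distMat_apply, Matrix.one_apply, h.1.1.dist_eq_zero_iff]
  have e1 := h.distMat_one_mul 0
  simp only [zero_add, h0] at e1
  have e2 := h.distMat_one_mul 1
  have e3 : classicalC q α 2 • Γ.distMat 2 = Γ.distMat 1 * Γ.distMat 1 -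
      classicalB D q α β 0 • 1 - classicalA D q α β 1 • Γ.distMat 1 := by
    rw [e1]; abel
  rw [← smul_mul_assoc, e3, sub_mul, sub_mul, mul_assoc, smul_mul_assoc, smul_mul_assoc, one_mul]
  nth_rw 1 [e2]
  simp only [mul_add, mul_smul_comm]

/-- The coefficients in the balanced set condition for the pair of distances `1, 2`. -/
noncomputable def balancedCoeff (D : ℕ) (q α β : ℝ) (i : ℕ) : ℝ :=
  if i = 1 then classicalB D q α β 1 / q else
  if i = 2 then classicalA D q α β 2 / (1 + q) else
  if i = 3 then classicalC q α 3 * q / (1 + q + q ^ 2) else 0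

/-- The single scalar identity to which the vanishing of the total quadratic form reduces. -/
theorem classical_balanced_identity {D : ℕ} {q α β : ℝ} (hq : q < -1) :
    classicalB D q α β 0 * (q + 1) + classicalA D q α β 1 * classicalA D q α β 2 =
      classicalB D q α β 1 * classicalC q α 2 * (1 + 1 / q) +
      classicalA D q α β 2 ^ 2 / (1 + q) -
      classicalB D q α β 2 * classicalC q α 3 * (1 + q) / (q * (1 + q + q ^ 2)) := by
  have hq0 : q ≠ 0 := by linarith
  have hq1 : 1 + q ≠ 0 := by linarith
  have hq3 : 1 + q + q ^ 2 ≠ 0 := by nlinarith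
  simp only [classicalA, classicalB, classicalC, gaussOne_zero, gaussOne_one, gaussOne_two,
    gaussOne_three, Nat.sub_self, show 2 - 1 = 1 from rfl,
    show 3 - 1 = 2 from rfl]
  generalize gaussOne q D = G
  field_simp
  ring

theorem HasClassicalParameters.sum_quadratic_eq_zero {D : ℕ} {q α β η : ℝ}
    (h : Γ.HasClassicalParameters D q α β) (hq : q < -1) (hc2 : classicalC q α 2 ≠ 0)
    {f : ℕ → ℝ} (hf : ∀ i, f i = dualEigenvalue η q i) {r : ℕ → ℝ}
    (hr : ∀ i, r i = balancedCoeff D q α β i) :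
    ∑ y, ∑ z, (f (Γ.dist y z) * ((Γ.distMat 1 * Γ.distMat 1) y z *
      (Γ.distMat 2 * Γ.distMat 2) y z) - f (Γ.dist y z) * (Γ.distMat 1 * Γ.distMat 2) y z ^ 2 +
      (f 0 - f (Γ.dist y z)) * r (Γ.dist y z) ^ 2 -
      2 * (f 1 - f 2) * ((Γ.distMat 1 * Γ.distMat 2) y z * r (Γ.dist y z))) = 0 := by
  have hq0 : q ≠ 0 := by linarith
  have hq1 : 1 + q ≠ 0 := by linarith
  have hq3 : 1 + q + q ^ 2 ≠ 0 := by nlinarith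
  set k := classicalB D q α β 0 with hk
  set b1 := classicalB D q α β 1 with hb1
  set b2 := classicalB D q α β 2 with hb2
  set a1 := classicalA D q α β 1 with ha1
  set a2 := classicalA D q α β 2 with ha2
  set c2 := classicalC q α 2 with hc2'
  set c3 := classicalC q α 3 with hc3
  have hc1 : classicalC q α 1 = 1 := by
    simp [classicalC, gaussOne_one, gaussOne_zero]
  have r0 : r 0 = 0 := by rw [hr]; simp [balancedCoeff]
  have r1 : r 1 = b1 / q := by rw [hr]; simp [balancedCoeff, hb1]
  have r2 : r 2 = a2 / (1 + q) := by rw [hr]; simp [balancedCoeff, ha2]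
  have r3 : r 3 = c3 * q / (1 + q + q ^ 2) := by rw [hr]; simp [balancedCoeff, hc3]
  have rr : ∀ i, r (i + 4) = 0 := fun i => by rw [hr]; simp [balancedCoeff]
  -- After multiplication by c_2 the summand depends only on the distance, and it vanishes beyond
  -- distance 3.
  have pt : ∀ y z, c2 * (f (Γ.dist y z) * ((Γ.distMat 1 * Γ.distMat 1) y z *
      (Γ.distMat 2 * Γ.distMat 2) y z) - f (Γ.dist y z) * (Γ.distMat 1 * Γ.distMat 2) y z ^ 2 +
      (f 0 - f (Γ.dist y z)) * r (Γ.dist y z) ^ 2 -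
      2 * (f 1 - f 2) * ((Γ.distMat 1 * Γ.distMat 2) y z * r (Γ.dist y z))) =
      (f 0 * k * (b1 * k)) * Γ.distMat 0 y z +
      (f 1 * a1 * (a2 * b1) - c2 * f 1 * b1 ^ 2 + c2 * (f 0 - f 1) * r 1 ^ 2 -
        2 * c2 * (f 1 - f 2) * b1 * r 1) * Γ.distMat 1 y z +
      (f 2 * c2 * (b1 * c2 + a2 ^ 2 + c3 * b2 - a1 * a2 - k) - c2 * f 2 * a2 ^ 2 +
        c2 * (f 0 - f 2) * r 2 ^ 2 - 2 * c2 * (f 1 - f 2) * a2 * r 2) * Γ.distMat 2 y z +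
      (- c2 * f 3 * c3 ^ 2 + c2 * (f 0 - f 3) * r 3 ^ 2 -
        2 * c2 * (f 1 - f 2) * c3 * r 3) * Γ.distMat 3 y z := by
    intro y z
    have eBB := congrFun₂ h.classicalC_two_smul_distMat_two_sq y z
    rw [h.distMat_one_mul 0, h.distMat_one_mul 1, h.distMat_one_mul 2] at eBB
    rw [h.distMat_one_mul 0, h.distMat_one_mul 1]
    simp only [Matrix.add_apply, Matrix.sub_apply, Matrix.smul_apply, smul_eq_mul, zero_add,
      Nat.reduceAdd, ← hk, ← hb1, ← hb2, ← ha1, ← ha2, ← hc2', ← hc3] at eBB ⊢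
    simp only [distMat_apply] at eBB ⊢
    rcases hd : Γ.dist y z with _ | _ | _ | _ | n
    · simp [hd, r0] at eBB ⊢
      linear_combination f 0 * k * eBB
    · simp [hd] at eBB ⊢
      linear_combination f 1 * a1 * eBB
    · simp [hd] at eBB ⊢
      linear_combination f 2 * c2 * eBB
    · simp [hd] at eBB ⊢
      ring
    · have := rr n
      simp [add_assoc] at this ⊢
      simp [this]
  have s1 := h.sum_distMat_succ 0
  have s2 := h.sum_distMat_succ 1
  have s3 := h.sum_distMat_succ 2
  simp only [zero_add, Nat.reduceAdd, hc1, one_mul, ← hk, ← hb1, ← hb2, ← hc2', ← hc3]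
    at s1 s2 s3
  apply mul_left_cancel₀ hc2
  simp only [mul_zero, mul_sum] at pt ⊢
  simp only [pt, sum_add_distrib, ← mul_sum]
  generalize ∑ x, ∑ y, Γ.distMat 0 x y = σ₀ at *
  generalize ∑ x, ∑ y, Γ.distMat 1 x y = σ₁ at *
  generalize ∑ x, ∑ y, Γ.distMat 2 x y = σ₂ at *
  generalize ∑ x, ∑ y, Γ.distMat 3 x y = σ₃ at *
  have key := sub_eq_zero.2 (classical_balanced_identity (D := D) (α := α) (β := β) hq)
  simp only [← hk, ← hb1, ← hb2, ← ha1, ← ha2, ← hc2', ← hc3] at key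
  have f0 : f 0 = η + 1 := by simp [hf, dualEigenvalue]
  have f1 : f 1 = η + q⁻¹ := by simp [hf, dualEigenvalue]
  have f2 : f 2 = η + (q ^ 2)⁻¹ := by simp [hf, dualEigenvalue]
  have f3 : f 3 = η + (q ^ 3)⁻¹ := by simp [hf, dualEigenvalue]
  -- The ratios of the σ's are known, so one scalar equation remains; it is the identity above times
  -- f 1 - f 2 = (q - 1)/q².
  have red : f 0 * k +
      (f 1 * a1 * a2 - c2 * f 1 * b1 + c2 * (f 0 - f 1) * (b1 / q ^ 2) -
        2 * c2 * (f 1 - f 2) * (b1 / q)) +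
      (f 2 * (b1 * c2 + a2 ^ 2 + c3 * b2 - a1 * a2 - k) - f 2 * a2 ^ 2 +
        (f 0 - f 2) * r 2 ^ 2 - 2 * (f 1 - f 2) * a2 * r 2) +
      (- f 3 * c3 + (f 0 - f 3) * c3 * (q / (1 + q + q ^ 2)) ^ 2 -
        2 * (f 1 - f 2) * c3 * (q / (1 + q + q ^ 2))) * b2 = 0 := by
    rw [r2, f0, f1, f2, f3]
    linear_combination (norm := (field_simp; ring)) ((q - 1) / q ^ 2) * key
  rw [r1, r3]
  linear_combination c2 * σ₂ * red - f 0 * k * b1 * s1 - (f 0 * k +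
    (f 1 * a1 * a2 - c2 * f 1 * b1 + c2 * (f 0 - f 1) * (b1 / q ^ 2) -
        2 * c2 * (f 1 - f 2) * (b1 / q))) * s2 +
      c2 * (- f 3 * c3 + (f 0 - f 3) * c3 * (q / (1 + q + q ^ 2)) ^ 2 -
        2 * (f 1 - f 2) * c3 * (q / (1 + q + q ^ 2))) * s3

/-- Since F² = cF with c > 0, each uᵀFu is |Fu|²/c. These are nonnegative with total 0, so every Fu
vanishes; the conclusion is its entry at x. The coefficient at distance h is p^h_{12}(f_1 -
f_2)/(f_0 - f_h). -/
theorem HasClassicalParameters.balanced {D : ℕ} {q α β : ℝ}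
    (h : Γ.HasClassicalParameters D q α β) (hq : q < -1) (hD : 2 ≤ D) (x y z : X) :
    ∑ w, (Γ.distMat 1 y w * Γ.distMat 2 w z - Γ.distMat 2 y w * Γ.distMat 1 w z) *
        (q ^ Γ.dist x w)⁻¹ =
      balancedCoeff D q α β (Γ.dist y z) * ((q ^ Γ.dist x y)⁻¹ - (q ^ Γ.dist x z)⁻¹) := by
  classical
  obtain ⟨η, θ, h0, hrec⟩ := h.exists_dualEigenvalue_recurrence hq hD x
  obtain ⟨c, hc, hconv⟩ := h.exists_conv_eq_mul x h0 hrec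
  have hc2 : classicalC q α 2 ≠ 0 := (h.classicalC_pos (x := x) (i := 1) hD).ne'
  have S := sum_quadratic_commutator (A := Γ.distMat 1) (B := Γ.distMat 2)
    (R := Matrix.of fun y z => balancedCoeff D q α β (Γ.dist y z))
    (F := Matrix.of fun y z => dualEigenvalue η q (Γ.dist y z))
    (f₀ := dualEigenvalue η q 0) (f₁ := dualEigenvalue η q 1) (f₂ := dualEigenvalue η q 2)
    (distMat_comm 1) (distMat_comm 2) (fun y z => by simp [dist_comm])
    (fun y z => by simp [dist_comm]) (h.distMat_one_mul_comm 1) (fun y => by simp)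
    (fun y z => by
      simp only [distMat_apply, Matrix.of_apply]; split_ifs with e <;> simp [e])
    (fun y z => by
      simp only [distMat_apply, Matrix.of_apply]; split_ifs with e <;> simp [e])
  simp only [Matrix.of_apply] at S
  rw [h.sum_quadratic_eq_zero hq hc2 (η := η) (fun _ => rfl) (fun _ => rfl), mul_zero] at S
  set u : X → X → X → ℝ := fun y z w => Γ.distMat 1 y w * Γ.distMat 2 w z -
    Γ.distMat 2 y w * Γ.distMat 1 w z - balancedCoeff D q α β (Γ.dist y z) *
      ((if w = y then 1 else 0) - if w = z then 1 else 0) with hu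
  have sqs : ∀ y z, ∑ w, ∑ w', dualEigenvalue η q (Γ.dist w w') * (u y z w * u y z w') =
      c⁻¹ * ∑ s, (∑ w, dualEigenvalue η q (Γ.dist s w) * u y z w) ^ 2 := fun y z => by
    rw [eq_inv_mul_iff_mul_eq₀ hc.ne', mul_sum]
    calc ∑ w, c * ∑ w', dualEigenvalue η q (Γ.dist w w') * (u y z w * u y z w')
        = ∑ w, ∑ w', ∑ s, dualEigenvalue η q (Γ.dist s w) * u y z w *
          (dualEigenvalue η q (Γ.dist s w') * u y z w') := by
          refine sum_congr rfl fun w _ => ?_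
          rw [mul_sum]
          refine sum_congr rfl fun w' _ => ?_
          rw [← mul_assoc, ← hconv, sum_mul]
          refine sum_congr rfl fun s _ => ?_
          rw [dist_comm (u := w)]
          ring
      _ = ∑ w, ∑ s, ∑ w', dualEigenvalue η q (Γ.dist s w) * u y z w *
          (dualEigenvalue η q (Γ.dist s w') * u y z w') :=
          sum_congr rfl fun w _ => sum_comm
      _ = ∑ s, ∑ w, ∑ w', dualEigenvalue η q (Γ.dist s w) * u y z w *
          (dualEigenvalue η q (Γ.dist s w') * u y z w') := sum_comm
      _ = _ := sum_congr rfl fun s _ => by rw [sq, sum_mul_sum]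
  replace S : ∑ y, ∑ z, ∑ w, ∑ w',
    dualEigenvalue η q (Γ.dist w w') * (u y z w * u y z w') = 0 := S
  simp only [sqs, ← mul_sum] at S
  have hS := (mul_eq_zero.1 S).resolve_left (inv_ne_zero hc.ne')
  have nn : ∀ y z, 0 ≤ ∑ s, (∑ w, dualEigenvalue η q (Γ.dist s w) * u y z w) ^ 2 :=
    fun y z => sum_nonneg fun s _ => sq_nonneg _
  have h1 := (sum_eq_zero_iff_of_nonneg fun y _ => sum_nonneg fun z _ => nn y z).1 hS y
    (mem_univ _)
  have h2 := (sum_eq_zero_iff_of_nonneg fun z _ => nn y z).1 h1 z (mem_univ _)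
  have h3 := (sum_eq_zero_iff_of_nonneg fun s _ => sq_nonneg _).1 h2 x (mem_univ _)
  have h4 := pow_eq_zero_iff (two_ne_zero) |>.1 h3
  -- A_1 and A_2 commute, so the constant η contributes nothing.
  have h5 : ∑ w, (Γ.distMat 1 y w * Γ.distMat 2 w z - Γ.distMat 2 y w * Γ.distMat 1 w z) = 0 := by
    rw [sum_sub_distrib, sub_eq_zero]
    simpa only [Matrix.mul_apply] using congrFun₂ (h.distMat_one_mul_comm 1) y z
  have h6 : ∑ w, dualEigenvalue η q (Γ.dist x w) * u y z w =
      η * ∑ w, (Γ.distMat 1 y w * Γ.distMat 2 w z - Γ.distMat 2 y w * Γ.distMat 1 w z) +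
      ∑ w, (Γ.distMat 1 y w * Γ.distMat 2 w z - Γ.distMat 2 y w * Γ.distMat 1 w z) *
        (q ^ Γ.dist x w)⁻¹ - ∑ w, ((if w = y then balancedCoeff D q α β (Γ.dist y z) *
          dualEigenvalue η q (Γ.dist x w) else 0) - if w = z then
            balancedCoeff D q α β (Γ.dist y z) * dualEigenvalue η q (Γ.dist x w) else 0) := by
    rw [mul_sum, ← sum_add_distrib, ← sum_sub_distrib]
    refine sum_congr rfl fun w _ => ?_
    simp only [hu, dualEigenvalue]
    split_ifs <;> ring
  rw [h4, h5, sum_sub_distrib, sum_ite_eq', sum_ite_eq', if_pos (mem_univ _),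
    if_pos (mem_univ _)] at h6
  simp only [dualEigenvalue] at h6
  linear_combination -h6

end Balanced

/-! ### Forbidden configurations: kites. -/

section Kites

variable {X : Type*} [Fintype X] {Γ : SimpleGraph X}

omit [Fintype X] in
theorem distMat_mul_nonneg (i j l : ℕ) (x y z w : X) :
    0 ≤ Γ.distMat i x w * Γ.distMat j w z * Γ.distMat l y w := by
  simp only [distMat_apply]
  positivity

/-- The balanced condition for the pair x, z, evaluated at y. In the first set only y is at distance
0 from y; in the second, the vertices adjacent to y are all c_2 common neighbors of y and z. The
remaining unknowns are the two sums in the conclusion. -/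
theorem HasClassicalParameters.kite_counts {D : ℕ} {q α β : ℝ}
    (h : Γ.HasClassicalParameters D q α β) (hq : q < -1) (hD : 2 ≤ D) {x y z : X}
    (hxz : Γ.dist x z = 3) (hxy : Γ.dist x y = 1) (hzy : Γ.dist z y = 2) :
    q * ∑ w, Γ.distMat 1 x w * Γ.distMat 2 w z * Γ.distMat 1 y w =
      ∑ w, Γ.distMat 2 x w * Γ.distMat 1 w z * Γ.distMat 2 y w := by
  have hq0 : q ≠ 0 := by linarith
  have hq1 : 1 + q ≠ 0 := by linarith
  have hq1' : q - 1 ≠ 0 := by linarith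
  have hq3 : 1 + q + q ^ 2 ≠ 0 := by nlinarith
  have hc := h.1.1
  have bal := h.balanced hq hD y x z
  rw [hxz, dist_comm (u := y), hxy, dist_comm (u := y), hzy] at bal
  simp only [sub_mul, sum_sub_distrib] at bal
  have e12 : ∑ w, Γ.distMat 1 x w * Γ.distMat 2 w z = classicalC q α 3 := by
    have := congrFun₂ (h.distMat_one_mul 1) x z
    simpa [Matrix.mul_apply, distMat_apply, hxz] using this
  have e21 : ∑ w, Γ.distMat 2 x w * Γ.distMat 1 w z = classicalC q α 3 := by
    rw [← e12]
    simpa only [Matrix.mul_apply] using congrFun₂ (h.distMat_one_mul_comm 1).symm x z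
  have e0 : ∑ w, Γ.distMat 1 x w * Γ.distMat 2 w z * Γ.distMat 0 y w = 1 := by
    rw [sum_eq_single y]
    · simp [distMat_apply, hxy, dist_comm (u := y) (v := z), hzy]
    · intro w _ hw
      simp [distMat_apply, hc.dist_eq_zero_iff, hw.symm]
    · simp
  have e11 : ∑ w, Γ.distMat 2 x w * Γ.distMat 1 w z * Γ.distMat 1 y w = classicalC q α 2 := by
    have := congrFun₂ (h.distMat_one_mul 0) y z
    simp only [Matrix.mul_apply, zero_add] at this
    have e : ∑ w, Γ.distMat 1 y w * Γ.distMat 1 w z = classicalC q α 2 := by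
      rw [this]
      simp [distMat_apply, dist_comm (u := y), hzy]
    rw [← e]
    refine sum_congr rfl fun w _ => ?_
    simp only [distMat_apply]
    have t1 := hc.dist_triangle (u := x) (v := y) (w := w)
    have t2 := hc.dist_triangle (u := x) (v := w) (w := z)
    by_cases h1 : Γ.dist y w = 1
    · by_cases h2 : Γ.dist w z = 1
      · have : Γ.dist x w = 2 := by omega
        simp [h1, h2, this]
      · simp [h2]
    · simp [h1]
  have p1 : ∀ w, Γ.distMat 1 x w * Γ.distMat 2 w z * (q ^ Γ.dist y w)⁻¹ =
      Γ.distMat 1 x w * Γ.distMat 2 w z * (q ^ 2)⁻¹ +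
      Γ.distMat 1 x w * Γ.distMat 2 w z * Γ.distMat 0 y w * (1 - (q ^ 2)⁻¹) +
      Γ.distMat 1 x w * Γ.distMat 2 w z * Γ.distMat 1 y w * (q⁻¹ - (q ^ 2)⁻¹) := fun w => by
    simp only [distMat_apply]
    have t1 := hc.dist_triangle (u := y) (v := x) (w := w)
    rw [dist_comm (u := y) (v := x)] at t1
    by_cases h1 : Γ.dist x w = 1
    · have : Γ.dist y w = 0 ∨ Γ.dist y w = 1 ∨ Γ.dist y w = 2 := by omega
      rcases this with h2 | h2 | h2 <;> simp only [h1, h2] <;> split_ifs <;> simp at *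
    · simp [h1]
  have p2 : ∀ w, Γ.distMat 2 x w * Γ.distMat 1 w z * (q ^ Γ.dist y w)⁻¹ =
      Γ.distMat 2 x w * Γ.distMat 1 w z * (q ^ 3)⁻¹ +
      Γ.distMat 2 x w * Γ.distMat 1 w z * Γ.distMat 1 y w * (q⁻¹ - (q ^ 3)⁻¹) +
      Γ.distMat 2 x w * Γ.distMat 1 w z * Γ.distMat 2 y w * ((q ^ 2)⁻¹ - (q ^ 3)⁻¹) := fun w => by
    simp only [distMat_apply]
    have t1 := hc.dist_triangle (u := x) (v := y) (w := w)
    have t2 := hc.dist_triangle (u := y) (v := x) (w := w)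
    rw [dist_comm (u := y) (v := x)] at t2
    by_cases h1 : Γ.dist x w = 2
    · have : Γ.dist y w = 1 ∨ Γ.dist y w = 2 ∨ Γ.dist y w = 3 := by omega
      rcases this with h2 | h2 | h2 <;> simp only [h1, h2] <;> split_ifs <;> simp at *
    · simp [h1]
  simp only [p1, p2, sum_add_distrib, ← sum_mul, e12, e21, e0, e11] at bal
  simp only [classicalC, balancedCoeff, gaussOne_one, gaussOne_two, gaussOne_three,
    show 2 - 1 = 1 from rfl, show 3 - 1 = 2 from rfl] at bal
  simp only [show (3 : ℕ) ≠ 1 by decide, show (3 : ℕ) ≠ 2 by decide, if_true, if_false] at bal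
  generalize ∑ w, Γ.distMat 1 x w * Γ.distMat 2 w z * Γ.distMat 1 y w = K at *
  generalize ∑ w, Γ.distMat 2 x w * Γ.distMat 1 w z * Γ.distMat 2 y w = M at *
  have : (q - 1) * (q * K - M) = 0 := by
    linear_combination (norm := (field_simp; ring)) q ^ 3 * bal
  exact sub_eq_zero.1 ((mul_eq_zero.1 this).resolve_left hq1')

/-- Here the negative type enters: both counts are nonnegative and q < 0, so both vanish. -/
theorem HasClassicalParameters.kite_counts_eq_zero {D : ℕ} {q α β : ℝ}
    (h : Γ.HasClassicalParameters D q α β) (hq : q < -1) (hD : 2 ≤ D) {x y z : X}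
    (hxz : Γ.dist x z = 3) (hxy : Γ.dist x y = 1) (hzy : Γ.dist z y = 2) (w : X) :
    Γ.distMat 1 x w * Γ.distMat 2 w z * Γ.distMat 1 y w = 0 ∧
      Γ.distMat 2 x w * Γ.distMat 1 w z * Γ.distMat 2 y w = 0 := by
  have e := h.kite_counts hq hD hxz hxy hzy
  have n1 : 0 ≤ ∑ w, Γ.distMat 1 x w * Γ.distMat 2 w z * Γ.distMat 1 y w :=
    sum_nonneg fun w _ => distMat_mul_nonneg ..
  have n2 : 0 ≤ ∑ w, Γ.distMat 2 x w * Γ.distMat 1 w z * Γ.distMat 2 y w :=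
    sum_nonneg fun w _ => distMat_mul_nonneg ..
  have z1 : ∑ w, Γ.distMat 1 x w * Γ.distMat 2 w z * Γ.distMat 1 y w = 0 := by nlinarith
  rw [z1, mul_zero] at e
  exact ⟨(sum_eq_zero_iff_of_nonneg fun w _ => distMat_mul_nonneg ..).1 z1 w (mem_univ _),
    (sum_eq_zero_iff_of_nonneg fun w _ => distMat_mul_nonneg ..).1 e.symm w (mem_univ _)⟩

/-- There are no kites of length three. -/
theorem HasClassicalParameters.not_kite_three {D : ℕ} {q α β : ℝ}
    (h : Γ.HasClassicalParameters D q α β) (hq : q < -1) (hD : 2 ≤ D) {x y z w : X}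
    (hxz : Γ.dist x z = 3) (hxy : Γ.dist x y = 1) (hzy : Γ.dist z y = 2)
    (hxw : Γ.dist x w = 1) (hzw : Γ.dist z w = 2) : Γ.dist y w ≠ 1 := fun hyw => by
  have := (h.kite_counts_eq_zero hq hD hxz hxy hzy w).1
  simp [distMat_apply, hxw, dist_comm (u := w), hzw, hyw] at this

theorem HasClassicalParameters.dist_ne_two {D : ℕ} {q α β : ℝ}
    (h : Γ.HasClassicalParameters D q α β) (hq : q < -1) (hD : 2 ≤ D) {x y z w : X}
    (hxz : Γ.dist x z = 3) (hxy : Γ.dist x y = 1) (hzy : Γ.dist z y = 2)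
    (hxw : Γ.dist x w = 2) (hzw : Γ.dist z w = 1) : Γ.dist y w ≠ 2 := fun hyw => by
  have := (h.kite_counts_eq_zero hq hD hxz hxy hzy w).2
  simp [distMat_apply, hxw, dist_comm (u := w), hzw, hyw] at this

/-- There are no kites of length two, that is, no induced subgraphs `K_{1,1,2}`. -/
theorem HasClassicalParameters.not_kite_two {D : ℕ} {q α β : ℝ}
    (h : Γ.HasClassicalParameters D q α β) (hq : q < -1) (hD : 3 ≤ D) {x y z w : X}
    (hxz : Γ.dist x z = 2) (hxy : Γ.dist x y = 1) (hzy : Γ.dist z y = 1)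
    (hxw : Γ.dist x w = 1) (hzw : Γ.dist z w = 1) : Γ.dist y w ≠ 1 := by
  -- Prolonging the path beyond z turns a kite of length two into one of length three.
  obtain ⟨u, hu, hu'⟩ := h.1.exists_dist_succ hxz (by rw [h.2.1]; omega)
  have hc := h.1.1
  have t1 := hc.dist_triangle (u := x) (v := y) (w := u)
  have t2 := hc.dist_triangle (u := y) (v := z) (w := u)
  have t3 := hc.dist_triangle (u := x) (v := w) (w := u)
  have t4 := hc.dist_triangle (u := w) (v := z) (w := u)
  rw [dist_comm (u := y) (v := z)] at t2
  rw [dist_comm (u := w) (v := z)] at t4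
  exact h.not_kite_three hq (by omega) hu' hxy (by rw [dist_comm]; omega) hxw
    (by rw [dist_comm]; omega)

/-- The balanced condition for the pair z, y, evaluated at x. By `hno` all c_2 common neighbors of x
and z are at distance two from y; since there are no kites of length three, all a_1 common neighbors
of x and y are at distance two from z. The only unknown count left is then 0. -/
theorem HasClassicalParameters.dist_ne_two_of_dist_eq_three {D : ℕ} {q α β : ℝ}
    (h : Γ.HasClassicalParameters D q α β) (hq : q < -1) (hD : 3 ≤ D) {x y z : X}
    (hxy : Γ.dist x y = 1) (hxz : Γ.dist x z = 2) (hyz : Γ.dist y z = 2)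
    (hno : ∀ w, Γ.dist x w = 1 → Γ.dist y w = 1 → Γ.dist z w ≠ 1) {w : X}
    (hzw : Γ.dist z w = 1) (hxw : Γ.dist x w = 3) : Γ.dist y w ≠ 2 := by
  have hq0 : q ≠ 0 := by linarith
  have hq1 : 1 + q ≠ 0 := by linarith
  have hq1' : q - 1 ≠ 0 := by linarith
  have hc := h.1.1
  have bal := h.balanced hq (by omega) x z y
  have hzx : Γ.dist z x = 2 := by rw [dist_comm, hxz]
  have hzy : Γ.dist z y = 2 := by rw [dist_comm, hyz]
  rw [hzy, hxz, hxy] at bal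
  simp only [sub_mul, sum_sub_distrib] at bal
  have e12 : ∑ w, Γ.distMat 1 z w * Γ.distMat 2 w y = classicalA D q α β 2 := by
    have := congrFun₂ (h.distMat_one_mul 1) z y
    simpa [Matrix.mul_apply, distMat_apply, hzy] using this
  have e21 : ∑ w, Γ.distMat 2 z w * Γ.distMat 1 w y = classicalA D q α β 2 := by
    rw [← e12]
    simpa only [Matrix.mul_apply] using congrFun₂ (h.distMat_one_mul_comm 1).symm z y
  have e0 : ∑ w, Γ.distMat 2 z w * Γ.distMat 1 w y * Γ.distMat 0 x w = 1 := by
    rw [sum_eq_single x]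
    · simp [distMat_apply, hxy, hzx]
    · intro w _ hw
      simp [distMat_apply, hc.dist_eq_zero_iff, hw.symm]
    · simp
  have e11 : ∑ w, Γ.distMat 1 z w * Γ.distMat 2 w y * Γ.distMat 1 x w = classicalC q α 2 := by
    have := congrFun₂ (h.distMat_one_mul 0) z x
    simp only [Matrix.mul_apply, zero_add] at this
    have e : ∑ w, Γ.distMat 1 z w * Γ.distMat 1 w x = classicalC q α 2 := by
      rw [this]
      simp [distMat_apply, hzx]
    rw [← e]
    refine sum_congr rfl fun w _ => ?_
    simp only [distMat_apply]
    have t1 := hc.dist_triangle (u := w) (v := x) (w := y)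
    have t2 := hc.dist_triangle (u := z) (v := w) (w := y)
    have t3 := hno w
    rw [dist_comm (u := x), dist_comm (u := y)] at t3
    rw [dist_comm (u := x) (v := w)]
    by_cases h1 : Γ.dist z w = 1
    · by_cases h2 : Γ.dist w x = 1
      · have : Γ.dist w y = 2 := by
          have := fun e => t3 h2 e h1
          omega
        simp [h1, h2, this]
      · simp [h2]
    · simp [h1]
  have ea : ∑ w, Γ.distMat 2 z w * Γ.distMat 1 w y * Γ.distMat 1 x w =
      classicalA D q α β 1 := by
    have := congrFun₂ (h.distMat_one_mul 0) x y
    simp only [Matrix.mul_apply, zero_add] at this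
    have e : ∑ w, Γ.distMat 1 x w * Γ.distMat 1 w y = classicalA D q α β 1 := by
      rw [this]
      simp [distMat_apply, hxy]
    rw [← e]
    refine sum_congr rfl fun w _ => ?_
    simp only [distMat_apply]
    by_cases h1 : Γ.dist x w = 1
    · by_cases h2 : Γ.dist w y = 1
      · have t1 := hc.dist_triangle (u := z) (v := x) (w := w)
        have t2 := hc.dist_triangle (u := z) (v := w) (w := x)
        rw [dist_comm (u := w) (v := x)] at t2
        have t3 := hno w h1 (by rw [dist_comm, h2])
        have t4 : Γ.dist z w ≠ 3 := fun e =>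
          h.not_kite_three hq (by omega) (x := w) (y := x) (z := z) (w := y)
            (by rw [dist_comm, e]) (by rw [dist_comm, h1]) hzx h2 hzy hxy
        have : Γ.dist z w = 2 := by omega
        simp [h1, h2, this]
      · simp [h2]
    · simp [h1]
  have p1 : ∀ w, Γ.distMat 1 z w * Γ.distMat 2 w y * (q ^ Γ.dist x w)⁻¹ =
      Γ.distMat 1 z w * Γ.distMat 2 w y * (q ^ 2)⁻¹ +
      Γ.distMat 1 z w * Γ.distMat 2 w y * Γ.distMat 1 x w * (q⁻¹ - (q ^ 2)⁻¹) +
      Γ.distMat 1 z w * Γ.distMat 2 w y * Γ.distMat 3 x w * ((q ^ 3)⁻¹ - (q ^ 2)⁻¹) :=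
    fun w => by
    simp only [distMat_apply]
    have t1 := hc.dist_triangle (u := x) (v := z) (w := w)
    have t2 := hc.dist_triangle (u := z) (v := w) (w := x)
    rw [dist_comm (u := w) (v := x)] at t2
    by_cases h1 : Γ.dist z w = 1
    · have : Γ.dist x w = 1 ∨ Γ.dist x w = 2 ∨ Γ.dist x w = 3 := by omega
      rcases this with h2 | h2 | h2 <;> simp only [h1, h2] <;> split_ifs <;> simp at *
    · simp [h1]
  have p2 : ∀ w, Γ.distMat 2 z w * Γ.distMat 1 w y * (q ^ Γ.dist x w)⁻¹ =
      Γ.distMat 2 z w * Γ.distMat 1 w y * (q ^ 2)⁻¹ +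
      Γ.distMat 2 z w * Γ.distMat 1 w y * Γ.distMat 0 x w * (1 - (q ^ 2)⁻¹) +
      Γ.distMat 2 z w * Γ.distMat 1 w y * Γ.distMat 1 x w * (q⁻¹ - (q ^ 2)⁻¹) := fun w => by
    simp only [distMat_apply]
    have t1 := hc.dist_triangle (u := x) (v := y) (w := w)
    rw [dist_comm (u := y) (v := w)] at t1
    by_cases h1 : Γ.dist w y = 1
    · have : Γ.dist x w = 0 ∨ Γ.dist x w = 1 ∨ Γ.dist x w = 2 := by omega
      rcases this with h2 | h2 | h2 <;> simp only [h1, h2] <;> split_ifs <;> simp at *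
    · simp [h1]
  simp only [p1, p2, sum_add_distrib, ← sum_mul, e12, e21, e0, e11, ea] at bal
  simp only [classicalC, classicalA, classicalB, balancedCoeff, gaussOne_zero, gaussOne_one,
    gaussOne_two, show 2 - 1 = 1 from rfl, show 1 - 1 = 0 from rfl] at bal
  simp only [show (2 : ℕ) ≠ 1 by decide, if_true, if_false] at bal
  have hQ : (q - 1) * ∑ w, Γ.distMat 1 z w * Γ.distMat 2 w y * Γ.distMat 3 x w = 0 := by
    generalize ∑ w, Γ.distMat 1 z w * Γ.distMat 2 w y * Γ.distMat 3 x w = K at *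
    generalize gaussOne q D = G at *
    linear_combination (norm := (field_simp; ring)) -q ^ 3 * bal
  have := (sum_eq_zero_iff_of_nonneg fun w _ => distMat_mul_nonneg ..).1
    ((mul_eq_zero.1 hQ).resolve_left hq1') w (mem_univ _)
  intro hyw
  simp [distMat_apply, hxw, dist_comm (u := w), hzw, hyw] at this

/-- Equality would give α = -q/(1 + q)² > 0, whereas c_2 = (1 + q)(1 + α) > 0 forces α < -1. -/
theorem HasClassicalParameters.classicalC_three_ne_two {D : ℕ} {q α β : ℝ}
    (h : Γ.HasClassicalParameters D q α β) (hq : q < -1) (hD : 2 ≤ D) (x : X) :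
    classicalC q α 3 ≠ classicalC q α 2 := fun e => by
  have hc2 := h.classicalC_pos (x := x) (i := 1) hD
  simp only [classicalC, gaussOne_one, gaussOne_two, gaussOne_three,
    show 2 - 1 = 1 from rfl, show 3 - 1 = 2 from rfl, Nat.reduceAdd] at e hc2
  have e' : q * (q + α * (1 + q) ^ 2) = 0 := by linear_combination e
  have e2 := (mul_eq_zero.1 e').resolve_left (by linarith)
  nlinarith

end Kites

/-! ### The local graph as a union of cliques, and the action of L and R. -/

section LocalCliques

variable {X : Type*} [Fintype X] {Γ : SimpleGraph X}

/-- The lowering matrix of `Γ` with respect to `x`, over the reals. -/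
noncomputable def realLowering (Γ : SimpleGraph X) (x : X) : Matrix X X ℝ :=
  Matrix.of fun y z => if Γ.dist y z = 1 ∧ Γ.dist x z = Γ.dist x y + 1 then 1 else 0

omit [Fintype X] in
theorem realLowering_apply (x y z : X) : Γ.realLowering x y z =
    if Γ.dist y z = 1 ∧ Γ.dist x z = Γ.dist x y + 1 then 1 else 0 := rfl

/-- The indicator of the pairs of vertices of the local graph at `x` that are equal or
adjacent. -/
noncomputable def localClique (Γ : SimpleGraph X) (x : X) : Matrix X X ℝ :=
  Matrix.of fun s t => if Γ.dist x s = 1 ∧ Γ.dist x t = 1 ∧ Γ.dist s t ≤ 1 then 1 else 0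

omit [Fintype X] in
theorem localClique_apply (x s t : X) : Γ.localClique x s t =
    if Γ.dist x s = 1 ∧ Γ.dist x t = 1 ∧ Γ.dist s t ≤ 1 then 1 else 0 := rfl

variable {D : ℕ} {q α β : ℝ}

/-- A failure of transitivity would be a kite of length two whose middle edge joins x and t. So the
local graph is a disjoint union of cliques. -/
theorem HasClassicalParameters.local_trans (h : Γ.HasClassicalParameters D q α β) (hq : q < -1)
    (hD : 3 ≤ D) {x s t y : X} (hs : Γ.dist x s = 1) (ht : Γ.dist x t = 1)
    (hy : Γ.dist x y = 1) (hst : Γ.dist s t ≤ 1) (hty : Γ.dist t y ≤ 1) : Γ.dist s y ≤ 1 := by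
  have hc := h.1.1
  rcases Nat.le_one_iff_eq_zero_or_eq_one.1 hst with e | e
  · rw [hc.dist_eq_zero_iff] at e; rwa [e]
  rcases Nat.le_one_iff_eq_zero_or_eq_one.1 hty with e' | e'
  · rw [hc.dist_eq_zero_iff] at e'; rwa [← e']
  by_contra hn
  have t1 := hc.dist_triangle (u := s) (v := t) (w := y)
  exact h.not_kite_two hq hD (x := s) (z := y) (y := t) (w := x) (by omega) e
    (by rw [dist_comm, e']) (by rw [dist_comm, hs]) (by rw [dist_comm, hy])
    (by rw [dist_comm, ht])

/-- Distinct common neighbors of two vertices at distance two are at distance two. -/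
theorem HasClassicalParameters.eq_of_common_neighbor (h : Γ.HasClassicalParameters D q α β)
    (hq : q < -1) (hD : 3 ≤ D) {x z s t : X} (hxz : Γ.dist x z = 2) (hs : Γ.dist x s = 1)
    (ht : Γ.dist x t = 1) (hzs : Γ.dist z s = 1) (hzt : Γ.dist z t = 1)
    (hst : Γ.dist s t ≤ 1) : s = t := by
  rcases Nat.le_one_iff_eq_zero_or_eq_one.1 hst with e | e
  · exact h.1.1.dist_eq_zero_iff.1 e
  · exact absurd e (h.not_kite_two hq hD hxz hs hzs ht hzt)

theorem HasClassicalParameters.sum_localClique (h : Γ.HasClassicalParameters D q α β)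
    {x y : X} (hy : Γ.dist x y = 1) :
    ∑ t, Γ.localClique x t y = 1 + classicalA D q α β 1 := by
  have e1 : ∑ t, Γ.distMat 0 t y = 1 := by
    rw [sum_eq_single y]
    · simp [distMat_apply]
    · intro w _ hw
      simp [distMat_apply, h.1.1.dist_eq_zero_iff, hw]
    · simp
  have e2 : ∑ t, Γ.distMat 1 x t * Γ.distMat 1 t y = classicalA D q α β 1 := by
    have := congrFun₂ (h.distMat_one_mul 0) x y
    simpa [Matrix.mul_apply, distMat_apply, hy] using this
  rw [← e1, ← e2, ← sum_add_distrib]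
  refine sum_congr rfl fun t _ => ?_
  simp only [localClique_apply, distMat_apply, hy]
  rcases h0 : Γ.dist t y with _ | _ | n
  · rw [h.1.1.dist_eq_zero_iff.1 h0]
    simp [hy]
  · by_cases hx : Γ.dist x t = 1 <;> simp [hx]
  · simp

theorem HasClassicalParameters.sum_localClique_mul (h : Γ.HasClassicalParameters D q α β)
    (hq : q < -1) (hD : 3 ≤ D) {x y : X} (hy : Γ.dist x y = 1) (s : X) :
    ∑ t, Γ.localClique x s t * Γ.localClique x t y =
      (1 + classicalA D q α β 1) * Γ.localClique x s y := by
  rw [← h.sum_localClique hy, sum_mul]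
  refine sum_congr rfl fun t _ => ?_
  by_cases hs : Γ.dist x s = 1
  swap
  · simp [localClique_apply, hs]
  by_cases ht : Γ.dist x t = 1
  swap
  · simp [localClique_apply, ht]
  simp only [localClique_apply, hs, ht, hy, true_and]
  by_cases hty : Γ.dist t y ≤ 1
  · have : Γ.dist s t ≤ 1 ↔ Γ.dist s y ≤ 1 :=
      ⟨fun e => h.local_trans hq hD hs ht hy e hty,
        fun e => h.local_trans hq hD hs hy ht e (by rwa [dist_comm])⟩
    simp [hty, this]
  · simp [hty]

/-- The entry counts common neighbors of s and t in Γ_2(x): b_1 if s = t, none if s and t are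
adjacent (a kite), and all common neighbors except x at distance two (another common neighbor
adjacent to x would give a kite). -/
theorem HasClassicalParameters.lowering_mul_raising (h : Γ.HasClassicalParameters D q α β)
    (hq : q < -1) (hD : 3 ≤ D) {x s t : X} (hs : Γ.dist x s = 1) (ht : Γ.dist x t = 1) :
    (Γ.realLowering x * (Γ.realLowering x).transpose) s t =
      classicalB D q α β 1 * Γ.distMat 0 s t +
        (classicalC q α 2 - 1) * (1 - Γ.localClique x s t) := by
  have hc := h.1.1
  simp only [Matrix.mul_apply, Matrix.transpose_apply]
  have tri := hc.dist_triangle (u := s) (v := x) (w := t)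
  rw [dist_comm (u := s) (v := x)] at tri
  have : Γ.dist s t = 0 ∨ Γ.dist s t = 1 ∨ Γ.dist s t = 2 := by omega
  rcases this with e | e | e
  · obtain rfl := hc.dist_eq_zero_iff.1 e
    have := h.card_dist_succ s x
    rw [dist_comm, hs] at this
    have e5 : Γ.localClique x s s = 1 := by simp [localClique_apply, hs]
    have e6 : Γ.distMat 0 s s = 1 := by simp [distMat_apply]
    rw [e5, e6, sub_self, mul_zero, add_zero, mul_one, ← this, card_filter, Nat.cast_sum]
    refine sum_congr rfl fun w _ => ?_
    simp only [realLowering_apply, hs, dist_comm (v := x)]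
    by_cases h1 : Γ.dist s w = 1 ∧ Γ.dist x w = 1 + 1
    · rw [if_pos h1, if_pos h1]; simp
    · rw [if_neg h1, if_neg h1]; simp
  · simp only [distMat_apply, localClique_apply, hs, ht, e]
    simp only [realLowering_apply, hs, ht]
    refine (sum_eq_zero fun w _ => ?_).trans (by simp)
    by_cases h1 : Γ.dist s w = 1 ∧ Γ.dist x w = 1 + 1
    · by_cases h2 : Γ.dist t w = 1
      · exact absurd e (h.not_kite_two hq hD h1.2 hs (by rw [dist_comm, h1.1]) ht
          (by rw [dist_comm, h2]))
      · rw [if_pos h1, if_neg fun e' => h2 e'.1, mul_zero]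
    · rw [if_neg h1, zero_mul]
  · have e1 := congrFun₂ (h.distMat_one_mul 0) s t
    have e2 : ∑ w, Γ.distMat 0 x w = 1 := by
      rw [sum_eq_single x]
      · simp [distMat_apply]
      · intro w _ hw
        simp [distMat_apply, h.1.1.dist_eq_zero_iff, hw.symm]
      · simp
    have e3 : ∑ w, Γ.distMat 1 s w * Γ.distMat 1 w t = classicalC q α 2 := by
      simpa [Matrix.mul_apply, distMat_apply, e] using e1
    have e5 : Γ.localClique x s t = 0 := by simp [localClique_apply, e]
    have e6 : Γ.distMat 0 s t = 0 := by simp [distMat_apply, e]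
    rw [e5, e6, mul_zero, zero_add, sub_zero, mul_one, ← e3, ← e2, ← sum_sub_distrib]
    refine sum_congr rfl fun w _ => ?_
    simp only [realLowering_apply, distMat_apply, hs, ht]
    rw [dist_comm (u := w)]
    by_cases h1 : Γ.dist s w = 1
    · by_cases h2 : Γ.dist t w = 1
      · have t1 := hc.dist_triangle (u := x) (v := s) (w := w)
        have n1 := h.not_kite_two hq hD (x := s) (z := t) (y := x) (w := w) e
          (by rw [dist_comm, hs]) (by rw [dist_comm, ht]) h1 h2
        have : Γ.dist x w = 0 ∨ Γ.dist x w = 2 := by omega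
        rcases this with e' | e' <;> simp [h1, h2, e']
      · have : Γ.dist x w ≠ 0 := fun h0 => by
          rw [hc.dist_eq_zero_iff] at h0
          rw [← h0, dist_comm] at h2; exact h2 ht
        simp [h2, this]
    · have : Γ.dist x w ≠ 0 := fun h0 => by
        rw [hc.dist_eq_zero_iff] at h0
        rw [← h0, dist_comm] at h1; exact h1 hs
      simp [h1, this]

/-- The difference of the indicators of two local cliques at `x`. -/
noncomputable def cliqueDiff (Γ : SimpleGraph X) (x y₁ y₂ : X) (t : X) : ℝ :=
  Γ.localClique x t y₁ - Γ.localClique x t y₂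

omit [Fintype X] in
theorem cliqueDiff_eq_zero {x y₁ y₂ t : X} (ht : Γ.dist x t ≠ 1) :
    Γ.cliqueDiff x y₁ y₂ t = 0 := by
  simp [cliqueDiff, localClique_apply, ht]

/-- All cliques have 1 + a_1 vertices, so the all-ones matrix kills the difference and the clique
matrix multiplies it by 1 + a_1. -/
theorem HasClassicalParameters.lowering_raising_cliqueDiff
    (h : Γ.HasClassicalParameters D q α β) (hq : q < -1) (hD : 3 ≤ D) {x y₁ y₂ : X}
    (h₁ : Γ.dist x y₁ = 1) (h₂ : Γ.dist x y₂ = 1) :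
    (Γ.realLowering x * (Γ.realLowering x).transpose).mulVec (Γ.cliqueDiff x y₁ y₂) =
      (classicalB D q α β 1 - (classicalC q α 2 - 1) * (1 + classicalA D q α β 1)) •
        Γ.cliqueDiff x y₁ y₂ := by
  ext s
  simp only [Matrix.mulVec, dotProduct, Pi.smul_apply, smul_eq_mul]
  by_cases hs : Γ.dist x s = 1
  · have e1 : ∀ t, (Γ.realLowering x * (Γ.realLowering x).transpose) s t *
        Γ.cliqueDiff x y₁ y₂ t =
        classicalB D q α β 1 * (Γ.distMat 0 s t * Γ.cliqueDiff x y₁ y₂ t) +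
        (classicalC q α 2 - 1) * (Γ.localClique x t y₁ - Γ.localClique x t y₂ -
          (Γ.localClique x s t * Γ.localClique x t y₁ -
            Γ.localClique x s t * Γ.localClique x t y₂)) := by
      intro t
      by_cases ht : Γ.dist x t = 1
      · rw [h.lowering_mul_raising hq hD hs ht, cliqueDiff]
        ring
      · rw [cliqueDiff_eq_zero ht]
        simp [localClique_apply, ht]
    simp only [e1, sum_add_distrib, ← mul_sum, sum_sub_distrib, h.sum_localClique h₁,
      h.sum_localClique h₂, h.sum_localClique_mul hq hD h₁, h.sum_localClique_mul hq hD h₂]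
    rw [sum_eq_single s]
    · simp only [distMat_apply, dist_self, if_true, cliqueDiff]
      ring
    · intro t _ hts
      simp [distMat_apply, h.1.1.dist_eq_zero_iff, hts.symm]
    · simp
  · rw [cliqueDiff_eq_zero hs, mul_zero]
    refine sum_eq_zero fun t _ => ?_
    by_cases ht : Γ.dist x t = 1
    · rw [Matrix.mul_apply, sum_eq_zero, zero_mul]
      intro w _
      simp only [Matrix.transpose_apply, realLowering_apply, ht]
      by_cases hw : Γ.dist x w = 2
      · have : Γ.dist x w ≠ Γ.dist x s + 1 := by omega
        simp [this]
      · simp [hw]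
    · rw [cliqueDiff_eq_zero ht, mul_zero]

theorem HasClassicalParameters.lowering_sq_apply (h : Γ.HasClassicalParameters D q α β)
    {x t w : X} (ht : Γ.dist x t = 1) (hw : Γ.dist x w = 3) :
    (Γ.realLowering x * Γ.realLowering x) t w = classicalC q α 2 * Γ.distMat 2 t w := by
  have hc := h.1.1
  have t0 := hc.dist_triangle (u := x) (v := t) (w := w)
  rw [Matrix.mul_apply]
  have e1 : ∀ s, Γ.realLowering x t s * Γ.realLowering x s w =
      Γ.distMat 1 t s * Γ.distMat 1 s w := fun s => by
    have t1 := hc.dist_triangle (u := x) (v := t) (w := s)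
    have t2 := hc.dist_triangle (u := x) (v := s) (w := w)
    simp only [realLowering_apply, distMat_apply, ht, hw]
    by_cases h1 : Γ.dist t s = 1
    · by_cases h2 : Γ.dist s w = 1
      · have : Γ.dist x s = 2 := by omega
        simp [h1, h2, this]
      · simp [h2]
    · simp [h1]
  simp only [e1]
  have e2 := congrFun₂ (h.distMat_one_mul 0) t w
  simp only [Matrix.mul_apply] at e2
  rw [zero_add] at e2
  rw [e2]
  simp only [Matrix.add_apply, Matrix.smul_apply, smul_eq_mul, distMat_apply]
  have n0 : Γ.dist t w ≠ 0 := by omega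
  have n1 : Γ.dist t w ≠ 1 := by omega
  simp [n0, n1]

/-- The number of neighbors of `z` at distance three from `x` and two from `t`. -/
noncomputable def farCount (Γ : SimpleGraph X) (x z t : X) : ℝ :=
  ∑ w, Γ.realLowering x z w * Γ.distMat 2 t w

theorem HasClassicalParameters.lowering_raising_sq_apply
    (h : Γ.HasClassicalParameters D q α β) {x z : X} (hz : Γ.dist x z = 2) {v : X → ℝ}
    (hv : ∀ t, Γ.dist x t ≠ 1 → v t = 0) :
    (Γ.realLowering x * ((Γ.realLowering x).transpose * (Γ.realLowering x).transpose)).mulVec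
      v z = classicalC q α 2 * ∑ t, v t * Γ.farCount x z t := by
  rw [← Matrix.transpose_mul]
  simp only [Matrix.mulVec, dotProduct, mul_sum, farCount]
  refine sum_congr rfl fun t _ => ?_
  by_cases ht : Γ.dist x t = 1
  · rw [Matrix.mul_apply, sum_mul]
    refine sum_congr rfl fun w _ => ?_
    rw [Matrix.transpose_apply]
    by_cases hw : Γ.dist x w = 3
    · rw [h.lowering_sq_apply ht hw]
      ring
    · simp [realLowering_apply, hz, hw]
  · simp [hv t ht]

/-- Of the c_3 neighbors of z at distance two from t, none is at distance two from x by
`dist_ne_two`, and those adjacent to x are exactly the c_2 common neighbors of x and z. -/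
theorem HasClassicalParameters.farCount_of_dist_eq_three
    (h : Γ.HasClassicalParameters D q α β) (hq : q < -1) (hD : 3 ≤ D) {x z t : X}
    (hz : Γ.dist x z = 2) (ht : Γ.dist x t = 1) (htz : Γ.dist t z = 3) :
    Γ.farCount x z t = classicalC q α 3 - classicalC q α 2 := by
  have hc := h.1.1
  have e1 : ∑ w, Γ.distMat 2 t w * Γ.distMat 1 w z = classicalC q α 3 := by
    have := congrFun₂ ((h.distMat_one_mul_comm 1).symm.trans (h.distMat_one_mul 1)) t z
    simpa [Matrix.mul_apply, distMat_apply, htz] using this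
  have e2 : ∑ w, Γ.distMat 1 x w * Γ.distMat 1 w z = classicalC q α 2 := by
    have := congrFun₂ (h.distMat_one_mul 0) x z
    simpa [Matrix.mul_apply, distMat_apply, hz] using this
  rw [farCount, ← e1, ← e2, ← sum_sub_distrib]
  refine sum_congr rfl fun w _ => ?_
  simp only [realLowering_apply, distMat_apply, hz]
  rw [dist_comm (u := w)]
  by_cases h1 : Γ.dist z w = 1
  · have t1 := hc.dist_triangle (u := t) (v := x) (w := w)
    have t2 := hc.dist_triangle (u := x) (v := t) (w := w)
    have t3 := hc.dist_triangle (u := t) (v := w) (w := z)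
    have t4 := hc.dist_triangle (u := x) (v := w) (w := z)
    rw [dist_comm (u := t) (v := x)] at t1
    rw [dist_comm (u := w) (v := z)] at t3 t4
    by_cases h2 : Γ.dist t w = 2
    · have := h.dist_ne_two hq (by omega) (x := t) (y := x) (z := z) (w := w) htz
        (by rw [dist_comm, ht]) (by rw [dist_comm, hz]) h2 h1
      have : Γ.dist x w = 1 ∨ Γ.dist x w = 3 := by omega
      rcases this with e | e <;> simp [h1, h2, e]
    · have : Γ.dist x w ≠ 1 := by omega
      simp [h2, this]
  · simp [h1]

theorem HasClassicalParameters.farCount_of_dist_eq_two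
    (h : Γ.HasClassicalParameters D q α β) (hq : q < -1) (hD : 3 ≤ D) {x z t : X}
    (hz : Γ.dist x z = 2) (ht : Γ.dist x t = 1) (htz : Γ.dist t z = 2)
    (hno : ∀ w, Γ.dist x w = 1 → Γ.dist t w = 1 → Γ.dist z w ≠ 1) :
    Γ.farCount x z t = 0 := by
  refine sum_eq_zero fun w _ => ?_
  simp only [realLowering_apply, distMat_apply, hz]
  by_cases h1 : Γ.dist z w = 1 ∧ Γ.dist x w = 2 + 1
  · simp [h.dist_ne_two_of_dist_eq_three hq hD ht hz htz hno h1.1 h1.2]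
  · rw [if_neg h1, zero_mul]

/-- Absence of kites of length three makes the distance to z constant on each of the two cliques.
The clique of y₁ contributes 0 and that of y₂ contributes (1 + a_1)(c_3 - c_2), so the value is
-c_2(1 + a_1)(c_3 - c_2). -/
theorem HasClassicalParameters.lowering_raising_sq_cliqueDiff_ne_zero
    (h : Γ.HasClassicalParameters D q α β) (hq : q < -1) (hD : 3 ≤ D) {x y₁ y₂ z : X}
    (hz : Γ.dist x z = 2) (h₁ : Γ.dist x y₁ = 1) (hz₁ : Γ.dist z y₁ = 2)
    (hno : ∀ w, Γ.dist x w = 1 → Γ.dist y₁ w = 1 → Γ.dist z w ≠ 1)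
    (h₂ : Γ.dist x y₂ = 1) (hz₂ : Γ.dist z y₂ = 3) (ha : 0 ≤ classicalA D q α β 1) :
    (Γ.realLowering x * ((Γ.realLowering x).transpose * (Γ.realLowering x).transpose)).mulVec
      (Γ.cliqueDiff x y₁ y₂) z ≠ 0 := by
  have hc := h.1.1
  rw [h.lowering_raising_sq_apply hz fun t ht => cliqueDiff_eq_zero ht]
  have e1 : ∀ t, Γ.localClique x t y₁ * Γ.farCount x z t = 0 := fun t => by
    rw [localClique_apply]
    split_ifs with ht
    · obtain ⟨hxt, -, hty⟩ := ht
      rw [one_mul]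
      have hzt : Γ.dist z t ≠ 1 := by
        rcases Nat.le_one_iff_eq_zero_or_eq_one.1 hty with e | e
        · rw [hc.dist_eq_zero_iff.1 e, hz₁]; decide
        · exact hno t hxt (by rw [dist_comm, e])
      have t1 := hc.dist_triangle (u := z) (v := x) (w := t)
      have t2 := hc.dist_triangle (u := x) (v := t) (w := z)
      rw [dist_comm (u := z) (v := x)] at t1
      rw [dist_comm (u := t) (v := z)] at t2
      have hzt3 : Γ.dist z t ≠ 3 := fun e3 => by
        rcases Nat.le_one_iff_eq_zero_or_eq_one.1 hty with e | e
        · rw [hc.dist_eq_zero_iff.1 e, hz₁] at e3; omega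
        · exact h.not_kite_three hq (by omega) (x := t) (y := x) (z := z) (w := y₁)
            (by rw [dist_comm, e3]) (by rw [dist_comm, hxt]) (by rw [dist_comm, hz]) e hz₁ h₁
      refine h.farCount_of_dist_eq_two hq hD hz hxt (by rw [dist_comm]; omega) fun w hw htw hzw => ?_
      have hyw := h.local_trans hq hD h₁ hxt hw (by rwa [dist_comm]) htw.le
      rcases Nat.le_one_iff_eq_zero_or_eq_one.1 hyw with e | e
      · rw [← hc.dist_eq_zero_iff.1 e] at hzw; omega
      · exact hno w hw e hzw
    · rw [zero_mul]
  have e2 : ∀ t, Γ.localClique x t y₂ * Γ.farCount x z t =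
      Γ.localClique x t y₂ * (classicalC q α 3 - classicalC q α 2) := fun t => by
    rw [localClique_apply]
    split_ifs with ht
    · obtain ⟨hxt, -, hty⟩ := ht
      have t1 := hc.dist_triangle (u := z) (v := x) (w := t)
      have t2 := hc.dist_triangle (u := z) (v := t) (w := y₂)
      rw [dist_comm (u := z) (v := x)] at t1
      have hzt : Γ.dist z t ≠ 2 := fun e3 => by
        rcases Nat.le_one_iff_eq_zero_or_eq_one.1 hty with e | e
        · rw [hc.dist_eq_zero_iff.1 e, hz₂] at e3; omega
        · exact h.not_kite_three hq (by omega) (x := y₂) (y := x) (z := z) (w := t)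
            (by rw [dist_comm, hz₂]) (by rw [dist_comm, h₂]) (by rw [dist_comm, hz])
            (by rw [dist_comm, e]) e3 hxt
      rw [h.farCount_of_dist_eq_three hq hD hz hxt (by rw [dist_comm]; omega)]
    · simp
  simp only [cliqueDiff, sub_mul, e1, e2, zero_sub, sum_neg_distrib, ← sum_mul,
    h.sum_localClique h₂]
  have c2 := (h.classicalC_pos (x := x) (i := 1) (by omega)).ne'
  have c3 := sub_ne_zero.2 (h.classicalC_three_ne_two hq (by omega) x)
  have : 1 + classicalA D q α β 1 ≠ 0 := by positivity
  exact mul_ne_zero c2 (by simpa [this] using c3)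

/-- Neither clique contains a neighbor of z. -/
theorem HasClassicalParameters.raising_cliqueDiff_eq_zero
    (h : Γ.HasClassicalParameters D q α β) {x y₁ y₂ z : X}
    (hz₁ : Γ.dist z y₁ = 2) (hno : ∀ w, Γ.dist x w = 1 → Γ.dist y₁ w = 1 → Γ.dist z w ≠ 1) (hz₂ : Γ.dist z y₂ = 3) :
    (Γ.realLowering x).transpose.mulVec (Γ.cliqueDiff x y₁ y₂) z = 0 := by
  have hc := h.1.1
  refine sum_eq_zero fun t _ => ?_
  change Γ.realLowering x t z * _ = 0
  rw [realLowering_apply]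
  split_ifs with ht
  · rw [one_mul, cliqueDiff, localClique_apply, localClique_apply, if_neg, if_neg, sub_zero]
    · rintro ⟨-, -, e⟩
      have t1 := hc.dist_triangle (u := z) (v := t) (w := y₂)
      rw [dist_comm (u := z) (v := t)] at t1
      omega
    · rintro ⟨hxt, -, e⟩
      rcases Nat.le_one_iff_eq_zero_or_eq_one.1 e with e | e
      · rw [hc.dist_eq_zero_iff] at e
        rw [e, dist_comm] at ht
        omega
      · exact hno t hxt (by rw [dist_comm, e]) (by rw [dist_comm, ht.1])
  · rw [zero_mul]

/-- For `z` at distance two from `x`, some vertex of the local graph at `x` is at distance two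
from `z` and lies in a local clique without neighbors of `z`. -/
theorem HasClassicalParameters.exists_far_clique (h : Γ.HasClassicalParameters D q α β)
    (hq : q < -1) (hD : 3 ≤ D)
    (ha : classicalA D q α β 2 ≠ classicalA D q α β 1 * classicalC q α 2) {x z : X}
    (hz : Γ.dist x z = 2) : ∃ y, Γ.dist x y = 1 ∧ Γ.dist z y = 2 ∧
      ∀ w, Γ.dist x w = 1 → Γ.dist y w = 1 → Γ.dist z w ≠ 1 := by
  have hc := h.1.1
  -- Double counting of edges between Γ(x) ∩ Γ(z) and Γ(x) ∩ Γ_2(z). Each of the c_2 vertices of the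
  -- first set has a_1 neighbors in the second; if no clique is far, each of the a_2 vertices of the
  -- second has exactly one neighbor in the first, so a_2 = a_1c_2.
  by_contra! hcon
  apply ha
  have e1 : ∑ y, Γ.distMat 1 x y * Γ.distMat 2 y z = classicalA D q α β 2 := by
    have := congrFun₂ (h.distMat_one_mul 1) x z
    simpa [Matrix.mul_apply, distMat_apply, hz] using this
  have e2 : ∑ w, Γ.distMat 1 x w * Γ.distMat 1 w z = classicalC q α 2 := by
    have := congrFun₂ (h.distMat_one_mul 0) x z
    simpa [Matrix.mul_apply, distMat_apply, hz] using this
  have e3 : ∀ w, Γ.dist x w = 1 → ∑ y, Γ.distMat 1 x y * Γ.distMat 1 y w =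
      classicalA D q α β 1 := fun w hw => by
    have := congrFun₂ (h.distMat_one_mul 0) x w
    simpa [Matrix.mul_apply, distMat_apply, hw] using this
  rw [← e1, ← e2, mul_sum]
  have e4 : ∀ w, classicalA D q α β 1 * (Γ.distMat 1 x w * Γ.distMat 1 w z) =
      ∑ y, Γ.distMat 1 x w * Γ.distMat 1 w z * (Γ.distMat 1 x y * Γ.distMat 1 y w) := fun w => by
    rw [← mul_sum]
    by_cases hw : Γ.dist x w = 1
    · rw [e3 w hw, mul_comm]
    · simp [distMat_apply, hw]
  simp only [e4]
  rw [sum_comm]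
  refine sum_congr rfl fun y _ => ?_
  by_cases hy : Γ.dist x y = 1
  swap
  · simp [distMat_apply, hy]
  by_cases hyz : Γ.dist z y = 2
  · obtain ⟨w₀, hw₀, hyw₀, hzw₀⟩ := hcon y hy hyz
    rw [sum_eq_single w₀]
    · simp [distMat_apply, hy, dist_comm (v := z), hyz, hw₀, hyw₀, hzw₀]
    · intro w _ hww
      by_contra hne
      apply hww
      simp only [distMat_apply] at hne
      have hw : Γ.dist x w = 1 ∧ Γ.dist w z = 1 ∧ Γ.dist y w = 1 := by
        by_contra hn
        apply hne
        split_ifs <;> simp_all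
      exact h.eq_of_common_neighbor hq hD hz hw.1 hw₀ (by rw [dist_comm, hw.2.1]) hzw₀
        (h.local_trans hq hD hw.1 hy hw₀ (by rw [dist_comm, hw.2.2]) hyw₀.le)
    · simp
  · have n2 : Γ.dist y z ≠ 2 := by rwa [dist_comm]
    simp only [distMat_apply, n2, if_false, mul_zero]
    refine (sum_eq_zero fun w _ => ?_).symm
    by_contra hne
    have hw : Γ.dist x w = 1 ∧ Γ.dist w z = 1 ∧ Γ.dist y w = 1 := by
      by_contra hn
      apply hne
      split_ifs <;> simp_all
    have t1 := hc.dist_triangle (u := y) (v := w) (w := z)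
    have t2 := hc.dist_triangle (u := x) (v := y) (w := z)
    have : Γ.dist y z = 1 := by omega
    exact h.not_kite_two hq hD hz hy (by rw [dist_comm, this]) hw.1
      (by rw [dist_comm, hw.2.1]) hw.2.2

end LocalCliques

/-! ### Distances and matrices of the graph without flat edges. -/

section FlatDeleted

variable {X : Type*} {Γ : SimpleGraph X}

theorem flatDeleted_le (x : X) : Γ.flatDeleted x ≤ Γ := fun _ _ h => h.1

theorem Connected.exists_flatDeleted_walk (hc : Γ.Connected) (x : X) :
    ∀ (n : ℕ) (y : X), Γ.dist x y = n → ∃ p : (Γ.flatDeleted x).Walk x y, p.length = n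
  | 0, y, hy => by
    obtain rfl := hc.dist_eq_zero_iff.1 hy
    exact ⟨Walk.nil, rfl⟩
  | n + 1, y, hy => by
    obtain ⟨z, hz, hz'⟩ := hc.exists_dist_eq (x := x) (y := y) (i := n) (by omega)
    obtain ⟨p, hp⟩ := hc.exists_flatDeleted_walk x n z hz
    have hadj : (Γ.flatDeleted x).Adj z y :=
      ⟨dist_eq_one_iff_adj.1 (by omega), by omega⟩
    exact ⟨p.concat hadj, by rw [Walk.length_concat, hp]⟩

theorem Connected.flatDeleted_connected (hc : Γ.Connected) (x : X) :
    (Γ.flatDeleted x).Connected := by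
  have hr : ∀ y, (Γ.flatDeleted x).Reachable x y := fun y => by
    obtain ⟨p, -⟩ := hc.exists_flatDeleted_walk x _ y rfl
    exact ⟨p⟩
  exact { preconnected := fun u v => (hr u).symm.trans (hr v), nonempty := ⟨x⟩ }

/-- Geodesics starting at x contain no flat edge, so they survive the deletion. -/
theorem Connected.flatDeleted_dist (hc : Γ.Connected) (x y : X) :
    (Γ.flatDeleted x).dist x y = Γ.dist x y := by
  refine le_antisymm ?_ ?_
  · obtain ⟨p, hp⟩ := hc.exists_flatDeleted_walk x _ y rfl
    exact hp ▸ dist_le p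
  · exact ((hc.flatDeleted_connected x) x y).dist_anti (flatDeleted_le x)

variable [Fintype X]

theorem Connected.dist_le_eccNat (hc : Γ.Connected) (x y : X) : Γ.dist x y ≤ Γ.eccNat x := by
  have : Nonempty X := ⟨x⟩
  have h1 : Γ.edist x y ≤ Γ.eccent x := edist_le_eccent
  have h2 : Γ.eccent x ≠ ⊤ := fun e => connected_iff_ediam_ne_top.1 hc (by
    rw [← top_le_iff, ← e]; exact eccent_le_ediam)
  rw [eccNat, SimpleGraph.dist]
  exact ENat.toNat_le_toNat h1 h2

theorem Connected.loweringMatrix_apply (hc : Γ.Connected) (x y z : X) :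
    Γ.loweringMatrix x y z =
      if Γ.dist y z = 1 ∧ Γ.dist x z = Γ.dist x y + 1 then 1 else 0 := by
  classical
  have hz := hc.dist_le_eccNat x z
  simp only [loweringMatrix, dualIdempotent, Matrix.sum_apply, Matrix.mul_diagonal,
    Matrix.diagonal_mul, adjMatrix_apply]
  by_cases h : Γ.dist y z = 1 ∧ Γ.dist x z = Γ.dist x y + 1
  · rw [if_pos h, sum_eq_single (Γ.dist x z)]
    · have : Γ.dist x y = Γ.dist x z - 1 := by omega
      simp [dist_eq_one_iff_adj.1 h.1, this]
    · intro i _ hi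
      simp [hi.symm]
    · intro hn
      exact absurd (mem_Icc.2 ⟨by omega, hz⟩) hn
  · rw [if_neg h]
    refine sum_eq_zero fun i hi => ?_
    rw [mem_Icc] at hi
    by_contra hne
    have h1 : Γ.dist x y = i - 1 ∧ Γ.Adj y z ∧ Γ.dist x z = i := by
      by_contra hn
      apply hne
      split_ifs <;> simp_all
    exact h ⟨dist_eq_one_iff_adj.2 h1.2.1, by omega⟩

theorem Connected.raisingMatrix_apply (hc : Γ.Connected) (x y z : X) :
    Γ.raisingMatrix x y z = Γ.loweringMatrix x z y := by
  classical
  have hy := hc.dist_le_eccNat x y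
  rw [hc.loweringMatrix_apply]
  simp only [raisingMatrix, dualIdempotent, Matrix.sum_apply, Matrix.mul_diagonal,
    Matrix.diagonal_mul, adjMatrix_apply]
  by_cases h : Γ.dist z y = 1 ∧ Γ.dist x y = Γ.dist x z + 1
  · rw [if_pos h, sum_eq_single (Γ.dist x z)]
    · simp [(dist_eq_one_iff_adj.1 h.1).symm, h.2]
    · intro i _ hi
      simp [hi.symm]
    · intro hn
      exact absurd (mem_range.2 (by omega)) hn
  · rw [if_neg h]
    refine sum_eq_zero fun i hi => ?_
    by_contra hne
    have h1 : Γ.dist x y = i + 1 ∧ Γ.Adj y z ∧ Γ.dist x z = i := by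
      by_contra hn
      apply hne
      split_ifs <;> simp_all
    exact h ⟨dist_eq_one_iff_adj.2 h1.2.1.symm, by omega⟩

theorem Connected.loweringMatrix_flatDeleted (hc : Γ.Connected) (x : X) :
    (Γ.flatDeleted x).loweringMatrix x = (Γ.realLowering x).map Complex.ofReal := by
  ext y z
  rw [(hc.flatDeleted_connected x).loweringMatrix_apply, Matrix.map_apply, realLowering_apply]
  have e : ((Γ.flatDeleted x).dist y z = 1 ∧
      (Γ.flatDeleted x).dist x z = (Γ.flatDeleted x).dist x y + 1) ↔
      (Γ.dist y z = 1 ∧ Γ.dist x z = Γ.dist x y + 1) := by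
    rw [hc.flatDeleted_dist, hc.flatDeleted_dist, dist_eq_one_iff_adj, dist_eq_one_iff_adj]
    exact ⟨fun h => ⟨h.1.1, h.2⟩, fun h => ⟨⟨h.1, by omega⟩, h.2⟩⟩
  by_cases h : Γ.dist y z = 1 ∧ Γ.dist x z = Γ.dist x y + 1
  · rw [if_pos (e.2 h), if_pos h, Complex.ofReal_one]
  · rw [if_neg fun h' => h (e.1 h'), if_neg h, Complex.ofReal_zero]

theorem Connected.raisingMatrix_flatDeleted (hc : Γ.Connected) (x : X) :
    (Γ.flatDeleted x).raisingMatrix x = (Γ.realLowering x).transpose.map Complex.ofReal := by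
  ext y z
  rw [(hc.flatDeleted_connected x).raisingMatrix_apply, hc.loweringMatrix_flatDeleted]
  rfl

end FlatDeleted

/-! ### Consequences of the uniform relation for eigenvectors of LR. -/

section Thin

variable {X : Type*} [Fintype X]

open Matrix
open scoped ComplexOrder

/-- A relation `e⁻ R L² + L R L + e⁺ L² R = f L` with `e⁺ ≠ 0`, valid on the range of `E`, forces
`L R² v` to be a multiple of `R v` for each eigenvector `v` of `L R` with `L v = 0`. -/
theorem exists_lowering_raising_sq_eq_smul {L R E : Matrix X X ℂ} (hLR : Lᴴ = R)
    {em ep f θ : ℂ} (hep : ep ≠ 0)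
    (hrel : ∀ w, E *ᵥ w = w → em • R *ᵥ (L *ᵥ (L *ᵥ w)) + L *ᵥ (R *ᵥ (L *ᵥ w)) +
      ep • L *ᵥ (L *ᵥ (R *ᵥ w)) = f • L *ᵥ w) {v : X → ℂ}
    (hv : L *ᵥ (R *ᵥ v) = θ • v) (hLv : L *ᵥ v = 0) (hE₁ : E *ᵥ (R *ᵥ v) = R *ᵥ v)
    (hE₂ : E *ᵥ (L *ᵥ (R *ᵥ (R *ᵥ v))) = L *ᵥ (R *ᵥ (R *ᵥ v))) :
    ∃ κ : ℂ, L *ᵥ (R *ᵥ (R *ᵥ v)) = κ • R *ᵥ v := by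
  have adj : ∀ a b : X → ℂ, star a ⬝ᵥ (L *ᵥ b) = star (R *ᵥ a) ⬝ᵥ b := fun a b => by
    rw [star_mulVec, ← hLR, conjTranspose_conjTranspose, dotProduct_mulVec]
  have adj' : ∀ a b : X → ℂ, star a ⬝ᵥ (R *ᵥ b) = star (L *ᵥ a) ⬝ᵥ b := fun a b => by
    rw [star_mulVec, hLR, dotProduct_mulVec]
  -- If θ = 0, then |Rv|² = ⟨v, LRv⟩ = 0.
  by_cases hθ : θ = 0
  · refine ⟨0, ?_⟩
    have : R *ᵥ v = 0 := by
      rw [← dotProduct_star_self_eq_zero, adj', hv, hθ]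
      simp
    simp [this]
  -- The relation applied to Rv, together with L²Rv = θLv = 0, makes L²R²v a multiple μ of v.
  · have h1 := hrel _ hE₁
    simp only [hv, mulVec_smul, hLv, mulVec_zero, smul_zero, zero_add, smul_smul] at h1
    set μ : ℂ := (f * θ - θ * θ) / ep with hμ
    have hμv : L *ᵥ (L *ᵥ (R *ᵥ (R *ᵥ v))) = μ • v := by
      have : ep • L *ᵥ (L *ᵥ (R *ᵥ (R *ᵥ v))) = (f * θ - θ * θ) • v := by
        rw [sub_smul, ← h1]
        simp
      rw [hμ, div_eq_inv_mul, mul_smul, ← this, smul_smul, inv_mul_cancel₀ hep, one_smul]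
    refine ⟨μ / θ, ?_⟩
    -- This vector is in the kernel of L, so the relation applied to it gives L²Ru = 0. Hence |u|² =
    -- ⟨u, LR²v⟩ = ⟨L²Ru, v⟩ = 0.
    set u := L *ᵥ (R *ᵥ (R *ᵥ v)) - (μ / θ) • R *ᵥ v with hu
    have hLu : L *ᵥ u = 0 := by
      rw [hu, mulVec_sub, mulVec_smul, hμv, hv, smul_smul, div_mul_cancel₀ _ hθ, sub_self]
    have hEu : E *ᵥ u = u := by
      rw [hu, mulVec_sub, mulVec_smul, hE₁, hE₂]
    have h2 := hrel u hEu
    rw [hLu] at h2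
    simp only [mulVec_zero, smul_zero, zero_add, add_zero] at h2
    have h3 := (smul_eq_zero.1 h2).resolve_left hep
    have h4 : star u ⬝ᵥ u = 0 := by
      conv_lhs => rw [hu, dotProduct_sub, ← hu]
      rw [dotProduct_smul, adj' u, hLu, adj, adj', adj', h3]
      simp
    exact sub_eq_zero.1 (dotProduct_star_self_eq_zero.1 h4)

end Thin

/-! ### Supports, and entries of RL² and LRL between levels one and two. -/

section Columns

variable {X : Type*} [Fintype X] {Γ : SimpleGraph X} {D : ℕ} {q α β : ℝ}

open Matrix

omit [Fintype X] in
theorem realLowering_eq_zero {x y z : X} (h : Γ.dist x z ≠ Γ.dist x y + 1) :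
    Γ.realLowering x y z = 0 := by
  rw [realLowering_apply, if_neg fun h' => h h'.2]

theorem raising_support {x : X} {n : ℕ} {v : X → ℝ} (hv : ∀ t, Γ.dist x t ≠ n → v t = 0) :
    ∀ t, Γ.dist x t ≠ n + 1 → ((Γ.realLowering x)ᵀ *ᵥ v) t = 0 := fun t ht => by
  refine sum_eq_zero fun s _ => ?_
  change Γ.realLowering x s t * v s = 0
  by_cases hs : Γ.dist x s = n
  · rw [realLowering_eq_zero (by omega), zero_mul]
  · rw [hv s hs, mul_zero]

theorem lowering_support {x : X} {n : ℕ} {v : X → ℝ} (hv : ∀ t, Γ.dist x t ≠ n + 1 → v t = 0) :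
    ∀ t, Γ.dist x t ≠ n → (Γ.realLowering x *ᵥ v) t = 0 := fun t ht => by
  refine sum_eq_zero fun s _ => ?_
  change Γ.realLowering x t s * v s = 0
  by_cases hs : Γ.dist x s = n + 1
  · rw [realLowering_eq_zero (by omega), zero_mul]
  · rw [hv s hs, mul_zero]

theorem HasClassicalParameters.lowering_cliqueDiff (h : Γ.HasClassicalParameters D q α β)
    {x y₁ y₂ : X} (h₁ : Γ.dist x y₁ = 1) (h₂ : Γ.dist x y₂ = 1) :
    Γ.realLowering x *ᵥ Γ.cliqueDiff x y₁ y₂ = 0 := by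
  ext s
  by_cases hs : Γ.dist x s = 0
  · obtain rfl := h.1.1.dist_eq_zero_iff.1 hs
    have : ∀ t, Γ.realLowering x x t * Γ.cliqueDiff x y₁ y₂ t = Γ.cliqueDiff x y₁ y₂ t := by
      intro t
      by_cases ht : Γ.dist x t = 1
      · rw [realLowering_apply, if_pos ⟨ht, by rw [dist_self, ht]⟩, one_mul]
      · rw [cliqueDiff_eq_zero ht, mul_zero]
    change ∑ t, Γ.realLowering x x t * Γ.cliqueDiff x y₁ y₂ t = 0
    simp only [this]
    simp only [cliqueDiff, sum_sub_distrib]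
    rw [h.sum_localClique h₁, h.sum_localClique h₂, sub_self]
  · exact lowering_support (fun t ht => cliqueDiff_eq_zero ht) s hs

/-- Every contributing walk passes through x, the only vertex at level 0. -/
theorem HasClassicalParameters.raising_lowering_sq_apply
    (h : Γ.HasClassicalParameters D q α β) {x s p : X} (hs : Γ.dist x s = 1)
    (hp : Γ.dist x p = 2) :
    ((Γ.realLowering x)ᵀ * (Γ.realLowering x * Γ.realLowering x)) s p = classicalC q α 2 := by
  have e2 : ∑ w, Γ.distMat 1 x w * Γ.distMat 1 w p = classicalC q α 2 := by
    have := congrFun₂ (h.distMat_one_mul 0) x p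
    simpa [Matrix.mul_apply, distMat_apply, hp] using this
  rw [Matrix.mul_apply, sum_eq_single x]
  · rw [transpose_apply, realLowering_apply, if_pos ⟨hs, by rw [hs, dist_self]⟩, one_mul,
      Matrix.mul_apply, ← e2]
    refine sum_congr rfl fun w _ => ?_
    simp only [realLowering_apply, distMat_apply, dist_self, hp]
    by_cases hw : Γ.dist x w = 1
    · by_cases hwp : Γ.dist w p = 1 <;> simp [hw, hwp]
    · simp [hw]
  · intro o _ ho
    rw [transpose_apply, realLowering_eq_zero, zero_mul]
    have := h.1.1.pos_dist_of_ne ho.symm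
    omega
  · simp

/-- Each common neighbor w of x and p differs from s, so it contributes c_2 - 1 if it lies outside
the clique of s and 0 otherwise. -/
theorem HasClassicalParameters.lowering_raising_lowering_apply
    (h : Γ.HasClassicalParameters D q α β) (hq : q < -1) (hD : 3 ≤ D) {x s p : X}
    (hs : Γ.dist x s = 1) (hp : Γ.dist x p = 2) (hsp : Γ.dist s p ≠ 1) :
    (Γ.realLowering x * (Γ.realLowering x)ᵀ * Γ.realLowering x) s p =
      (classicalC q α 2 - 1) * (classicalC q α 2 -
        ∑ w, Γ.localClique x s w * Γ.distMat 1 w p) := by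
  have e2 : ∑ w, Γ.distMat 1 x w * Γ.distMat 1 w p = classicalC q α 2 := by
    have := congrFun₂ (h.distMat_one_mul 0) x p
    simpa [Matrix.mul_apply, distMat_apply, hp] using this
  nth_rw 2 [← e2]
  rw [← sum_sub_distrib, mul_sum, Matrix.mul_apply]
  refine sum_congr rfl fun w _ => ?_
  by_cases hw : Γ.dist x w = 1
  · rw [h.lowering_mul_raising hq hD hs hw, realLowering_apply, hp, hw]
    by_cases hwp : Γ.dist w p = 1
    · have : Γ.dist s w ≠ 0 := fun e => by
        rw [h.1.1.dist_eq_zero_iff] at e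
        exact hsp (by rw [e, hwp])
      simp only [distMat_apply, hwp, hw, this]
      simp
    · simp [distMat_apply, hwp]
  · rw [realLowering_eq_zero (by omega), mul_zero]
    simp [distMat_apply, localClique_apply, hw]

theorem HasClassicalParameters.sum_localClique_distMat_eq_zero
    (h : Γ.HasClassicalParameters D q α β) {x s p : X} (hsp : Γ.dist s p = 3) :
    ∑ w, Γ.localClique x s w * Γ.distMat 1 w p = 0 := by
  refine sum_eq_zero fun w _ => ?_
  have t := h.1.1.dist_triangle (u := s) (v := w) (w := p)
  by_cases hw : Γ.dist w p = 1
  · have : ¬ Γ.dist s w ≤ 1 := by omega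
    simp [localClique_apply, this]
  · simp [distMat_apply, hw]

theorem HasClassicalParameters.sum_localClique_distMat_eq_one
    (h : Γ.HasClassicalParameters D q α β) (hq : q < -1) (hD : 3 ≤ D) {x s p w : X}
    (hs : Γ.dist x s = 1) (hp : Γ.dist x p = 2) (hw : Γ.dist x w = 1) (hwp : Γ.dist p w = 1)
    (hsw : Γ.dist s w = 1) : ∑ w, Γ.localClique x s w * Γ.distMat 1 w p = 1 := by
  rw [sum_eq_single w]
  · rw [dist_comm] at hwp
    simp [localClique_apply, distMat_apply, hs, hw, hsw, hwp]
  · intro w' _ hne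
    by_contra hn
    apply hne
    simp only [localClique_apply, distMat_apply] at hn
    have hw' : Γ.dist x w' = 1 ∧ Γ.dist s w' ≤ 1 ∧ Γ.dist w' p = 1 := by
      by_contra hn'
      apply hn
      split_ifs <;> simp_all
    exact h.eq_of_common_neighbor hq hD hp hw'.1 hw (by rw [dist_comm, hw'.2.2]) hwp
      (h.local_trans hq hD hw'.1 hs hw (by rw [dist_comm]; exact hw'.2.1) hsw.le)
  · simp

end Columns

/-! ### The near polygon condition in terms of the parameters. -/

section NearPolygon

variable {X : Type*} [Fintype X] {Γ : SimpleGraph X} {D : ℕ} {q α β : ℝ}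

theorem HasClassicalParameters.drgA_eq (h : Γ.HasClassicalParameters D q α β) (x : X) {i : ℕ}
    (hi : i ≤ D) (hD : 1 ≤ D) : (Γ.drgA i : ℝ) = classicalA D q α β i := by
  obtain ⟨hr, rfl, -⟩ := id h
  obtain ⟨y, rfl⟩ := hr.exists_dist_eq x hi
  rw [drgA, ← hr.sphereInterCard_eq hi hD hi rfl, ← h.card_dist_eq x y, sphereInterCard]
  congr 2
  ext z
  simp [dist_comm (u := y)]

theorem HasClassicalParameters.drgC_eq (h : Γ.HasClassicalParameters D q α β) {i : ℕ}
    (hi₁ : 1 ≤ i) (hi : i ≤ D) : (Γ.drgC i : ℝ) = classicalC q α i :=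
  h.2.2.1 i hi₁ hi

/-- For q ≠ -1 the vanishing at i = 1 is equivalent to α(q + 1 + a_1) = 0, and this makes the
difference vanish for every i. So a_2 = a_1c_2 already yields the numerical condition for a near
polygon. -/
theorem classicalA_sub (D : ℕ) (q α β : ℝ) (i : ℕ) :
    classicalA D q α β (i + 1) - classicalA D q α β 1 * classicalC q α (i + 1) =
      -α * gaussOne q (i + 1) * gaussOne q i * (q + 1 + classicalA D q α β 1) := by
  simp only [classicalA, classicalB, classicalC, Nat.add_sub_cancel, gaussOne_zero, gaussOne_one,
    Nat.sub_self, gaussOne_succ q i]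
  ring

theorem HasClassicalParameters.not_isIndContained (h : Γ.HasClassicalParameters D q α β)
    (hq : q < -1) (hD : 3 ≤ D) : ¬ K112.IsIndContained Γ := by
  rintro ⟨f⟩
  let a : Σ i : Fin 3, Fin (![1, 1, 2] i) := ⟨0, (0 : Fin 1)⟩
  let b : Σ i : Fin 3, Fin (![1, 1, 2] i) := ⟨1, (0 : Fin 1)⟩
  let c : Σ i : Fin 3, Fin (![1, 1, 2] i) := ⟨2, (0 : Fin 2)⟩
  let d : Σ i : Fin 3, Fin (![1, 1, 2] i) := ⟨2, (1 : Fin 2)⟩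
  have adj : ∀ u v : Σ i : Fin 3, Fin (![1, 1, 2] i), u.1 ≠ v.1 → Γ.dist (f u) (f v) = 1 :=
    fun u v huv => dist_eq_one_iff_adj.2 (f.map_adj_iff.2 huv)
  have hcd : Γ.dist (f c) (f d) = 2 := by
    have h1 : Γ.dist (f c) (f d) ≠ 1 := fun e => by
      have := f.map_adj_iff.1 (dist_eq_one_iff_adj.1 e)
      exact this rfl
    have h0 : Γ.dist (f c) (f d) ≠ 0 := fun e => by
      have := f.injective (h.1.1.dist_eq_zero_iff.1 e)
      simp only [c, d] at this
      exact absurd this (by decide)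
    have t := h.1.1.dist_triangle (u := f c) (v := f a) (w := f d)
    rw [adj c a (by decide), adj a d (by decide)] at t
    omega
  exact h.not_kite_two hq hD hcd (adj c a (by decide)) (adj d a (by decide))
    (adj c b (by decide)) (adj d b (by decide)) (adj a b (by decide))

theorem HasClassicalParameters.classicalA_two_ne (h : Γ.HasClassicalParameters D q α β)
    (hq : q < -1) (hD : 3 ≤ D) (hnp : ¬ Γ.IsNearPolygon) (x : X) :
    classicalA D q α β 2 ≠ classicalA D q α β 1 * classicalC q α 2 := fun e => by
  refine hnp ⟨h.1, fun i hi hi' => ?_, h.not_isIndContained hq hD⟩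
  rw [h.2.1] at hi'
  have e' := classicalA_sub D q α β 1
  rw [e, sub_self, gaussOne_two, gaussOne_one] at e'
  obtain ⟨j, rfl⟩ : ∃ j, i = j + 1 := ⟨i - 1, by omega⟩
  have e2 := classicalA_sub D q α β j
  have h0 : α * (q + 1 + classicalA D q α β 1) = 0 := by
    have : (1 + q) * (α * (q + 1 + classicalA D q α β 1)) = 0 := by linear_combination e'
    exact (mul_eq_zero.1 this).resolve_left (by linarith)
  have e3 : classicalA D q α β (j + 1) = classicalA D q α β 1 * classicalC q α (j + 1) := by
    linear_combination e2 - gaussOne q (j + 1) * gaussOne q j * h0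
  rw [← h.drgA_eq x (by omega) (by omega), ← h.drgA_eq x (by omega) (by omega),
    ← h.drgC_eq (by omega) (by omega)] at e3
  exact_mod_cast e3

end NearPolygon

/-! ### The contradiction at level two. -/

section Main

variable {X : Type*} [Fintype X] {Γ : SimpleGraph X} {D : ℕ} {q α β : ℝ}

open Matrix

theorem map_ofReal_mulVec (M : Matrix X X ℝ) (v : X → ℝ) :
    M.map Complex.ofReal *ᵥ (fun t => (v t : ℂ)) = fun t => (((M *ᵥ v) t : ℝ) : ℂ) := by
  ext t
  simp [mulVec, dotProduct]

theorem dualIdempotent_mulVec_ofReal (hc : Γ.Connected) {x : X} {i : ℕ} {v : X → ℝ}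
    (hv : ∀ t, Γ.dist x t ≠ i → v t = 0) :
    (Γ.flatDeleted x).dualIdempotent x i *ᵥ (fun t => (v t : ℂ)) = fun t => (v t : ℂ) := by
  classical
  ext t
  rw [dualIdempotent, mulVec_diagonal, hc.flatDeleted_dist]
  split_ifs with ht
  · rw [one_mul]
  · rw [hv t ht]; simp

/-- The two cases are of different nature: e^+ = 0 is refuted by entries of a single column, e^+ ≠ 0
by an eigenvector of LR. -/
theorem HasClassicalParameters.not_lowering_relation (h : Γ.HasClassicalParameters D q α β)
    (hq : q < -1) (hD : 3 ≤ D) (ha₁ : 0 < classicalA D q α β 1)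
    (ha₂ : classicalA D q α β 2 ≠ classicalA D q α β 1 * classicalC q α 2) (x : X)
    {em ep f : ℂ} (hne : em ≠ 0 ∨ ep ≠ 0) {L R : Matrix X X ℂ}
    (hL : L = (Γ.realLowering x).map Complex.ofReal)
    (hR : R = (Γ.realLowering x)ᵀ.map Complex.ofReal)
    (hrel : ∀ w, (Γ.flatDeleted x).dualIdempotent x 2 *ᵥ w = w →
      em • R *ᵥ (L *ᵥ (L *ᵥ w)) + L *ᵥ (R *ᵥ (L *ᵥ w)) +
      ep • L *ᵥ (L *ᵥ (R *ᵥ w)) = f • L *ᵥ w) : False := by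
  classical
  have hc := h.1.1
  obtain ⟨z, hz⟩ := h.1.exists_dist_eq x (i := 2) (by rw [h.2.1]; omega)
  obtain ⟨y₂, hy₂, hzy₂⟩ := h.1.exists_dist_succ (x := z) (y := x) (i := 2)
    (by rw [dist_comm, hz]) (by rw [h.2.1]; omega)
  by_cases hep : ep = 0
  · have hem := hne.resolve_right (not_not.2 hep)
    -- The (s, z)-entry of the relation: L itself contributes nothing because s and z are not
    -- adjacent.
    have col : ∀ s, Γ.dist x s = 1 → Γ.dist s z ≠ 1 →
        em * (classicalC q α 2 : ℝ) + (((classicalC q α 2 - 1) * (classicalC q α 2 -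
        ∑ w, Γ.localClique x s w * Γ.distMat 1 w z) : ℝ) : ℂ) = 0 := by
      intro s hs hsz
      have := hrel (fun t => ((Pi.single z 1 : X → ℝ) t : ℂ)) (dualIdempotent_mulVec_ofReal hc
        fun t ht => by
          rw [Pi.single_apply, if_neg]
          rintro rfl
          exact ht hz)
      simp only [hL, hR, map_ofReal_mulVec, hep, zero_smul, add_zero] at this
      have e := congrFun this s
      simp only [Pi.add_apply, Pi.smul_apply, smul_eq_mul, mulVec_mulVec, mulVec_single_one,
        col_apply] at e
      have hcol : ∀ M N : Matrix X X ℝ, (M *ᵥ N.col z) s = (M * N) s z := fun _ _ => rfl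
      rw [hcol, hcol, Matrix.mul_assoc (Γ.realLowering x)ᵀ, h.raising_lowering_sq_apply hs hz,
        h.lowering_raising_lowering_apply hq hD hs hz hsz, realLowering_apply,
        if_neg fun h' => hsz h'.1] at e
      simpa using e
    have hzy₂' : Γ.dist y₂ z = 3 := by rw [dist_comm, hzy₂]
    have c1 := col y₂ hy₂ (by omega)
    rw [h.sum_localClique_distMat_eq_zero hzy₂'] at c1
    obtain ⟨w, hw, hwz⟩ := hc.exists_dist_eq (x := x) (y := z) (i := 1) (by omega)
    have hwz' : Γ.dist z w = 1 := by rw [dist_comm]; omega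
    -- Such a vertex exists because a_1 > 0; its clique contains exactly one neighbor of z, while
    -- the clique of y₂ contains none.
    obtain ⟨s, hs, hsw⟩ : ∃ s, Γ.dist x s = 1 ∧ Γ.dist s w = 1 := by
      by_contra! hcon
      have := h.card_dist_eq x w
      rw [hw, filter_eq_empty_iff.2 fun s _ hs => hcon s hs.1 hs.2, card_empty] at this
      rw [← this] at ha₁
      simp at ha₁
    have hsz : Γ.dist s z ≠ 1 := fun e =>
      h.not_kite_two hq hD hz hs (by rw [dist_comm, e]) hw hwz' hsw
    have c2 := col s hs hsz
    rw [h.sum_localClique_distMat_eq_one hq hD hs hz hw hwz' hsw] at c2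
    -- The two equations differ by c_2 - 1, which therefore vanishes; what remains is e^- = 0.
    have c3 : ((classicalC q α 2 : ℝ) : ℂ) = 1 := by
      push_cast at c1 c2
      linear_combination c1 - c2
    rw [c3] at c1
    have c4 : classicalC q α 2 = 1 := by exact_mod_cast c3
    rw [c4] at c1
    apply hem
    simpa using c1
  · obtain ⟨y₁, hy₁, hzy₁, hno⟩ := h.exists_far_clique hq hD ha₂ hz
    have sv : ∀ t, Γ.dist x t ≠ 1 → Γ.cliqueDiff x y₁ y₂ t = 0 := fun t => cliqueDiff_eq_zero
    have sRv := raising_support sv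
    have sRRv := raising_support sRv
    have sLRRv := lowering_support sRRv
    obtain ⟨κ, hκ⟩ := exists_lowering_raising_sq_eq_smul (L := L) (R := R)
      (E := (Γ.flatDeleted x).dualIdempotent x 2) (v := fun t => (Γ.cliqueDiff x y₁ y₂ t : ℂ))
      (θ := ((classicalB D q α β 1 -
        (classicalC q α 2 - 1) * (1 + classicalA D q α β 1) : ℝ) : ℂ))
      (by rw [hL, hR]; ext; simp) hep hrel
      (by
        simp only [hL, hR, map_ofReal_mulVec, mulVec_mulVec,
          h.lowering_raising_cliqueDiff hq hD hy₁ hy₂]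
        ext t
        simp)
      (by
        simp only [hL, map_ofReal_mulVec, h.lowering_cliqueDiff hy₁ hy₂]
        ext t
        simp)
      (by
        simp only [hR, map_ofReal_mulVec]
        exact dualIdempotent_mulVec_ofReal hc sRv)
      (by
        simp only [hL, hR, map_ofReal_mulVec]
        exact dualIdempotent_mulVec_ofReal hc sLRRv)
    simp only [hL, hR, map_ofReal_mulVec] at hκ
    have e := congrFun hκ z
    simp only [Pi.smul_apply, h.raising_cliqueDiff_eq_zero hzy₁ hno hzy₂] at e
    rw [Complex.ofReal_zero, smul_zero, Complex.ofReal_eq_zero, mulVec_mulVec, mulVec_mulVec] at e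
    refine h.lowering_raising_sq_cliqueDiff_ne_zero hq hD hz hy₁ hzy₁ hno hy₂ hzy₂ ha₁.le ?_
    rw [← Matrix.mul_assoc]
    exact e

end Main

end SimpleGraph

open SimpleGraph in
theorem theorem6p3 {X : Type*} [Fintype X] (Γ : SimpleGraph X)
    (hΓ : Γ.IsDistanceRegular) (hD : 3 ≤ Γ.diam) (hneg : Γ.IsOfNegativeType)
    (ha₁ : Γ.drgA 1 ≠ 0) (hnp : ¬ Γ.IsNearPolygon) (x : X) :
    ¬ Γ.SupportsUniformStructure x := by
  rintro ⟨U, f, hU, hrel⟩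
  obtain ⟨q, α, β, hq, h⟩ := hneg
  have hc := hΓ.1
  have hε : 3 ≤ (Γ.flatDeleted x).eccNat x := by
    obtain ⟨y, hy⟩ := hΓ.exists_dist_eq x hD
    rw [← hy, ← hc.flatDeleted_dist]
    exact (hc.flatDeleted_connected x).dist_le_eccNat x y
  have ha : 0 < classicalA Γ.diam q α β 1 := by
    rw [← h.drgA_eq x (by omega) (by omega)]
    exact_mod_cast Nat.pos_of_ne_zero ha₁
  refine h.not_lowering_relation hq hD ha (h.classicalA_two_ne hq hD hnp x) x
    (em := eMinus U 2) (ep := ePlus ((Γ.flatDeleted x).eccNat x) U 2) (f := f 2) ?_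
    (hc.loweringMatrix_flatDeleted x) (hc.raisingMatrix_flatDeleted x) fun w hw => ?_
  -- Since ε ≥ 3, neither e_2^- nor e_2^+ is a boundary value set to 0, so the off-diagonal
  -- condition makes one of them nonzero; e_{2,3} is its second alternative at i = 3.
  · rw [eMinus, if_pos le_rfl, ePlus, if_pos hε]
    exact hU.offDiag.imp (fun h' => h' 2 (Finset.mem_Icc.2 ⟨le_rfl, by omega⟩))
      fun h' => h' 3 (Finset.mem_Icc.2 ⟨by omega, hε⟩)
  · have := hrel 2 (Finset.mem_Icc.2 ⟨by omega, by omega⟩) w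
    simp only [hw, Matrix.add_mulVec, Matrix.smul_mulVec, ← Matrix.mulVec_mulVec] at this
    exact this
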